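/- **Setting.** Consider a finite polygonal mesh with cells $i$, edges $e$, vertices $j$ on a closed oriented surface (no boundary) made of flat triangular facets, in which every edge joins two different vertices and separates two different cells, together with its dual mesh. The dual vertex $i$ lies in the primal cell $i$, and the primal edge $e$ meets the dual edge $e$ at a point $x_e$; joining each dual vertex to the vertices and to the points $x_e$ on the boundary of its cell divides every $n$-gon, primal or dual, into $2n$ flat nondegenerate triangles, which are the facets (the supermesh). Let $\mathbf k$ be the unit normal of the surface. Every primal edge carries a unit tangent $\mathbf t$ and unit normal $\mathbf n$ with $\mathbf t=\mathbf k\times\mathbf n$; the unit tangent $\mathbf m$ of the dual edge points to the side to which $\mathbf n$ points. Put $t_{ej}=1$ (resp. $-1$) if $e$ is incident on $j$ and $\mathbf t$ points towards (resp. away from) $j$, and $n_{ei}=1$ (resp. $-1$) if $\mathbf n$ points out of (resp. into) cell $i$, and $0$ otherwise; $D_1=(t_{ej})$, $D_2=(n_{ei})^T$, $\overline D_1=-D_2^T$, $\overline D_2=D_1^T$. **Compound elements.** $\mathbf V_0$ consists of the continuous piecewise linear functions on the supermesh whose tangential derivative is constant along each primal edge and which are discretely harmonic in each cell (the integral over the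 cell of $\nabla\psi\cdot\nabla\eta$ vanishes for all continuous piecewise linear $\eta$ that vanish on the primal edges). $\mathbf V_1$ consists of the lowest order Raviart–Thomas fields on the supermesh whose normal component is constant along each primal edge, whose divergence is constant in each cell, and whose discrete curl vanishes in each cell (the integral over the cell of $\mathbf u\cdot\nabla^\perp\eta$ vanishes for the same $\eta$). $\mathbf V_2$ consists of the functions that are constant on each cell. $\mathbf V^0$ and $\mathbf V^2$ are the spaces $\mathbf V_0$ and $\mathbf V_2$ of the dual mesh, and $\mathbf V^1$ consists of the fields $\mathbf k\times\mathbf u$ with $\mathbf u$ in the space $\mathbf V_1$ of the dual mesh. **Claim.** There are unique families $\alpha_i\in\mathbf V_2$, $\mathbf v_e\in\mathbf V_1$, $\gamma_j\in\mathbf V_0$, $\beta_j\in\mathbf V^2$, $\mathbf w_e\in\mathbf V^1$, $\chi_i\in\mathbf V^0$ with $\int_{\text{cell }i'}\alpha_i\,dA=\delta_{ii'}$, $\int_{\text{edge }e'}\mathbf v_e\cdot\mathbf n\,dl=\delta_{ee'}$, $\gamma_j(\text{vertex }j')=\delta_{jj'}$, $\int_{\text{dual cell }j'}\beta_j\,dA=\delta_{jj'}$,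 $\int_{\text{dual edge }e'}\mathbf w_e\cdot\mathbf m\,dl=\delta_{ee'}$, $\chi_i(\text{dual vertex }i')=\delta_{ii'}$. With the $L^2$ inner product $\langle\cdot,\cdot\rangle$ let $L=\langle\alpha_i,\alpha_{i'}\rangle$, $M=\langle\mathbf v_e,\mathbf v_{e'}\rangle$, $N=\langle\gamma_j,\gamma_{j'}\rangle$ be the mass matrices and $H=\langle\mathbf v_e,\mathbf w_{e'}\rangle$, $J=\langle\gamma_j,\beta_{j'}\rangle$, $I=\langle\alpha_i,\chi_{i'}\rangle$ the discrete Hodge star matrices. Then $$\overline D_2H=J\overline D_2,\qquad \overline D_1I=H\overline D_1 .$$ Here $\overline D_1$ and $\overline D_2$ represent strong derivatives: on every facet $\nabla\sum_i\hat p_i\chi_i=\sum_e(\overline D_1\hat P)_e\mathbf w_e$ and $\mathbf k\cdot\nabla\times\sum_e\hat u_e\mathbf w_e=\sum_j(\overline D_2\hat U)_j\beta_j$. The matrices $L,M,N$ are invertible; $M^{-1}\overline D_1L$ is the matrix of the weak gradient $\mathbf V_2\to\mathbf V_1$ (defined by $\langle\mathbf u,\mathbf g\rangle=-\langle\nabla\cdot\mathbf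 u,\phi\rangle$ for all $\mathbf u\in\mathbf V_1$) and $N^{-1}\overline D_2M$ that of the weak curl $\mathbf V_1\to\mathbf V_0$ (defined by $\langle\psi,\xi\rangle=-\langle\nabla^\perp\psi,\mathbf u\rangle$ for all $\psi\in\mathbf V_0$). They factor as a Hodge star, a dual strong derivative, and a Hodge star back: $$M^{-1}\overline D_1L=(M^{-1}H)\,\overline D_1\,(I^{-1}L)\ \text{ if } I \text{ is invertible},\qquad N^{-1}\overline D_2M=(N^{-1}J)\,\overline D_2\,(H^{-1}M)\ \text{ if } H\text{ is invertible}.$$ -/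

import Mathlib

open MeasureTheory Matrix

noncomputable section

namespace CompoundFE

/-- The Euclidean plane, in which every flat triangular facet is drawn. -/
abbrev Plane : Type := EuclideanSpace ℝ (Fin 2)

/-- The operation `a ↦ k × a`: rotation by a right angle, counterclockwise. -/
def rot (a : Plane) : Plane := !₂[-(a 1), a 0]

/-- The planar cross product `k · (a × b)`. -/
def cross (a b : Plane) : ℝ := a 0 * b 1 - a 1 * b 0

/-- Unit tangent of the segment directed from `A` to `B`. -/
def unitTangent (A B : Plane) : Plane := (dist A B)⁻¹ • (B - A)

/-- Unit normal `n` of the segment directed from `A` to `B`, with `t = k × n`. -/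
def unitNormal (A B : Plane) : Plane := -rot (unitTangent A B)

/-- Line integral over the segment from `A` to `B` with respect to arc length. -/
def lineIntegral (A B : Plane) (g : Plane → ℝ) : ℝ :=
  (∫ t in (0 : ℝ)..1, g (AffineMap.lineMap A B t)) * dist A B

/-- Divergence of a planar vector field. -/
def pdiv (u : Plane → Plane) (x : Plane) : ℝ :=
  fderiv ℝ u x (EuclideanSpace.single 0 1) 0 + fderiv ℝ u x (EuclideanSpace.single 1 1) 1

/-- Scalar curl `k · ∇ × u` of a planar vector field. -/
def pcurl (u : Plane → Plane) (x : Plane) : ℝ :=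
  fderiv ℝ u x (EuclideanSpace.single 0 1) 1 - fderiv ℝ u x (EuclideanSpace.single 1 1) 0

/-- A polygonal mesh on a closed oriented surface made of flat triangular facets, with its dual mesh
and the common supermesh of triangular subelements.

`V`, `E`, `C` are the primal vertices, edges and cells.  The primal edge `e` and its dual edge cross
at a point `x_e`; joining the dual vertex (centre) of every cell to the vertices and to the points
`x_e` on the boundary of the cell divides an `n`-gon into `2n` triangles.  `F` is the set of these
triangles: `f : F` has corners at the primal vertex `vtx f`, at the crossing point of the edge
`edge f`, and at the centre of the cell `cell f`.  The triangles adjacent to `f` are `ρ₀ f` (across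
the side opposite to the primal vertex), `ρ₁ f` (across the side opposite to the edge point) and
`ρ₂ f` (across the side opposite to the cell centre).

Facet `f` is drawn in the plane, compatibly with the orientation `k` of the surface, with corners
`pt₀ f` (primal vertex), `pt₁ f` (edge point), `pt₂ f` (cell centre); facets are glued by
isometries along sides.  A polyhedral surface in space and a flat periodic domain are special
cases. -/
structure Mesh (F V E C : Type*) where
  vtx : F → V
  edge : F → E
  cell : F → C
  ρ₀ : F → F
  ρ₁ : F → F
  ρ₂ : F → F
  ρ₀_invol : ∀ f, ρ₀ (ρ₀ f) = f
  ρ₁_invol : ∀ f, ρ₁ (ρ₁ f) = f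
  ρ₂_invol : ∀ f, ρ₂ (ρ₂ f) = f
  ρ_comm : ∀ f, ρ₀ (ρ₂ f) = ρ₂ (ρ₀ f)
  vtx_surj : Function.Surjective vtx
  edge_surj : Function.Surjective edge
  cell_surj : Function.Surjective cell
  /-- The triangles around a primal vertex form one cycle. -/
  vtx_eq_iff : ∀ f g, vtx f = vtx g ↔ Relation.ReflTransGen (fun a b => b = ρ₁ a ∨ b = ρ₂ a) f g
  /-- The four triangles at an edge. -/
  edge_eq_iff : ∀ f g, edge f = edge g ↔ (g = f ∨ g = ρ₀ f ∨ g = ρ₂ f ∨ g = ρ₀ (ρ₂ f))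
  /-- The triangles around the centre of a primal cell form one cycle. -/
  cell_eq_iff : ∀ f g, cell f = cell g ↔ Relation.ReflTransGen (fun a b => b = ρ₁ a ∨ b = ρ₀ a) f g
  /-- An edge joins two different vertices. -/
  vtx_ne : ∀ f, vtx (ρ₀ f) ≠ vtx f
  /-- An edge separates two different cells. -/
  cell_ne : ∀ f, cell (ρ₂ f) ≠ cell f
  /-- `+1` if edge point, primal vertex, cell centre run counterclockwise around the triangle. -/
  sgn : F → ℤˣ
  sgn_ρ₀ : ∀ f, sgn (ρ₀ f) = -sgn f
  sgn_ρ₁ : ∀ f, sgn (ρ₁ f) = -sgn f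
  sgn_ρ₂ : ∀ f, sgn (ρ₂ f) = -sgn f
  /-- The choice of a tangent direction `t` of every primal edge: `+1` if `t` at `edge f` points
  towards `vtx f`, and `-1` if it points away. -/
  head : F → ℤˣ
  head_ρ₀ : ∀ f, head (ρ₀ f) = -head f
  head_ρ₂ : ∀ f, head (ρ₂ f) = head f
  pt₀ : F → Plane
  pt₁ : F → Plane
  pt₂ : F → Plane
  /-- The facets are nondegenerate and drawn with the right orientation. -/
  oriented : ∀ f, 0 < ((sgn f : ℤ) : ℝ) * cross (pt₀ f - pt₁ f) (pt₂ f - pt₁ f)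
  glue_ρ₀ : ∀ f, dist (pt₁ (ρ₀ f)) (pt₂ (ρ₀ f)) = dist (pt₁ f) (pt₂ f)
  glue_ρ₁ : ∀ f, dist (pt₀ (ρ₁ f)) (pt₂ (ρ₁ f)) = dist (pt₀ f) (pt₂ f)
  glue_ρ₂ : ∀ f, dist (pt₀ (ρ₂ f)) (pt₁ (ρ₂ f)) = dist (pt₀ f) (pt₁ f)

/-- A scalar field: one function per facet, of which only the values on the facet matter (all
fields below are polynomials on each facet, and are identified with these polynomials). -/
abbrev SField (F : Type*) : Type _ := F → Plane → ℝ

/-- A tangential vector field: one planar vector field per facet. -/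
abbrev VField (F : Type*) : Type _ := F → Plane → Plane

/-- Facetwise gradient. -/
def grad {F : Type*} (q : SField F) : VField F := fun f => gradient (q f)

/-- Facetwise `∇^⊥ = k × ∇`. -/
def gradPerp {F : Type*} (q : SField F) : VField F := fun f x => rot (grad q f x)

/-- Facetwise divergence. -/
def div {F : Type*} (u : VField F) : SField F := fun f => pdiv (u f)

/-- Facetwise curl `k · ∇ ×`. -/
def curl {F : Type*} (u : VField F) : SField F := fun f => pcurl (u f)

namespace Mesh

variable {F V E C : Type*}

/-- The dual mesh: cells and vertices are exchanged.  The tangent of the dual edge is the vector `m`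
pointing to the side to which the normal `n` of the primal edge points. -/
def dual (S : Mesh F V E C) : Mesh F C E V where
  vtx := S.cell
  edge := S.edge
  cell := S.vtx
  ρ₀ := S.ρ₂
  ρ₁ := S.ρ₁
  ρ₂ := S.ρ₀
  ρ₀_invol := S.ρ₂_invol
  ρ₁_invol := S.ρ₁_invol
  ρ₂_invol := S.ρ₀_invol
  ρ_comm f := (S.ρ_comm f).symm
  vtx_surj := S.cell_surj
  edge_surj := S.edge_surj
  cell_surj := S.vtx_surj
  vtx_eq_iff := S.cell_eq_iff
  edge_eq_iff f g := by
    rw [S.edge_eq_iff, S.ρ_comm]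
    tauto
  cell_eq_iff := S.vtx_eq_iff
  vtx_ne := S.cell_ne
  cell_ne := S.vtx_ne
  sgn f := -S.sgn f
  sgn_ρ₀ f := by rw [S.sgn_ρ₂]
  sgn_ρ₁ f := by rw [S.sgn_ρ₁]
  sgn_ρ₂ f := by rw [S.sgn_ρ₀]
  head f := -(S.sgn f * S.head f)
  head_ρ₀ f := by simp [S.sgn_ρ₂, S.head_ρ₂]
  head_ρ₂ f := by simp [S.sgn_ρ₀, S.head_ρ₀]
  pt₀ := S.pt₂
  pt₁ := S.pt₁
  pt₂ := S.pt₀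
  oriented f := by
    have h := S.oriented f
    simp only [cross, Units.val_neg, Int.cast_neg] at h ⊢
    linarith
  glue_ρ₀ f := by simpa [dist_comm] using S.glue_ρ₂ f
  glue_ρ₁ f := by simpa [dist_comm] using S.glue_ρ₁ f
  glue_ρ₂ f := by simpa [dist_comm] using S.glue_ρ₀ f

/-- `+1` if the triangle lies to the left of the directed edge, so that the normal `n` of the edge
(with `t = k × n`) points out of `cell f`; `-1` if `n` points into `cell f`. -/
def side (S : Mesh F V E C) (f : F) : ℤˣ := S.sgn f * S.head f

/-- The closed triangle of a facet. -/
def tri (S : Mesh F V E C) (f : F) : Set Plane := convexHull ℝ {S.pt₀ f, S.pt₁ f, S.pt₂ f}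

/-! ### Incidence matrices -/

open Classical in
/-- `t_{e j}`: is `1` if `e` is incident on `j` and its tangent points towards `j`, `-1` if it
points away from `j`, and `0` otherwise. -/
def D₁ (S : Mesh F V E C) : Matrix E V ℝ := Matrix.of fun e j =>
  if ∃ f, S.edge f = e ∧ S.vtx f = j ∧ S.head f = 1 then 1
  else if ∃ f, S.edge f = e ∧ S.vtx f = j ∧ S.head f = -1 then -1
  else 0

open Classical in
/-- The transpose of `n_{e i}`, which is `1` if the normal at `e` points out of the cell `i`, `-1` if
it points into `i`, and `0` otherwise. -/
def D₂ (S : Mesh F V E C) : Matrix C E ℝ := Matrix.of fun i e =>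
  if ∃ f, S.edge f = e ∧ S.cell f = i ∧ S.side f = 1 then 1
  else if ∃ f, S.edge f = e ∧ S.cell f = i ∧ S.side f = -1 then -1
  else 0

/-- Matrix of the strong gradient on the dual spaces. -/
def D₁bar (S : Mesh F V E C) : Matrix E C ℝ := -(S.D₂)ᵀ

/-- Matrix of the strong curl on the dual spaces. -/
def D₂bar (S : Mesh F V E C) : Matrix V E ℝ := (S.D₁)ᵀ

/-! ### Integrals -/

/-- `∫ p q dA` over the surface. -/
def sInner [Fintype F] (S : Mesh F V E C) (p q : SField F) : ℝ :=
  ∑ f, ∫ x in S.tri f, p f x * q f x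

/-- `∫ u · w dA` over the surface. -/
def vInner [Fintype F] (S : Mesh F V E C) (u w : VField F) : ℝ :=
  ∑ f, ∫ x in S.tri f, inner ℝ (u f x) (w f x)

open Classical in
/-- Integral of a scalar field over the cell `i`. -/
def cellIntegral [Fintype F] (S : Mesh F V E C) (i : C) (q : SField F) : ℝ :=
  ∑ f with S.cell f = i, ∫ x in S.tri f, q f x

open Classical in
/-- Flux `∫ u · n dl` through the edge `e`, which consists of two segments; the field is evaluated
on the two facets to the left of the edge. -/
def edgeFlux [Fintype F] (S : Mesh F V E C) (e : E) (u : VField F) : ℝ :=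
  ∑ f with S.edge f = e ∧ S.side f = 1, ((S.head f : ℤ) : ℝ) *
    lineIntegral (S.pt₁ f) (S.pt₀ f) fun x => inner ℝ (u f x) (unitNormal (S.pt₁ f) (S.pt₀ f))

open Classical in
/-- Circulation `∫ u · t dl` along the edge `e`, evaluated on the two facets to its left. -/
def edgeCirculation [Fintype F] (S : Mesh F V E C) (e : E) (u : VField F) : ℝ :=
  ∑ f with S.edge f = e ∧ S.side f = 1, ((S.head f : ℤ) : ℝ) *
    lineIntegral (S.pt₁ f) (S.pt₀ f) fun x => inner ℝ (u f x) (unitTangent (S.pt₁ f) (S.pt₀ f))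

/-! ### Lowest order spaces on the triangular supermesh -/

/-- Continuity of a scalar field across the sides joining the corners `A f`, `B f`. -/
def ContAcross (ρ : F → F) (A B : F → Plane) (q : SField F) : Prop :=
  ∀ f, ∀ t ∈ Set.Icc (0 : ℝ) 1, q (ρ f) (AffineMap.lineMap (A (ρ f)) (B (ρ f)) t) =
    q f (AffineMap.lineMap (A f) (B f) t)

/-- Continuity of the normal component of a vector field across the sides joining `A f`, `B f`. -/
def NormalContAcross (ρ : F → F) (A B : F → Plane) (u : VField F) : Prop :=
  ∀ f, ∀ t ∈ Set.Icc (0 : ℝ) 1,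
    inner ℝ (u (ρ f) (AffineMap.lineMap (A (ρ f)) (B (ρ f)) t)) (unitNormal (A (ρ f)) (B (ρ f))) =
      inner ℝ (u f (AffineMap.lineMap (A f) (B f) t)) (unitNormal (A f) (B f))

/-- Continuous piecewise linear elements. -/
def P1 (S : Mesh F V E C) : Set (SField F) :=
  {q | (∀ f, ∃ (a : Plane) (b : ℝ), ∀ x, q f x = inner ℝ a x + b) ∧
    ContAcross S.ρ₀ S.pt₁ S.pt₂ q ∧ ContAcross S.ρ₁ S.pt₀ S.pt₂ q ∧ ContAcross S.ρ₂ S.pt₀ S.pt₁ q}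

/-- Lowest order Raviart-Thomas elements. -/
def RT0 (S : Mesh F V E C) : Set (VField F) :=
  {u | (∀ f, ∃ (a : Plane) (b : ℝ), ∀ x, u f x = a + b • x) ∧
    NormalContAcross S.ρ₀ S.pt₁ S.pt₂ u ∧ NormalContAcross S.ρ₁ S.pt₀ S.pt₂ u ∧
    NormalContAcross S.ρ₂ S.pt₀ S.pt₁ u}

/-- Piecewise linear test functions that vanish on all edges of the mesh, that is, on the boundary
of every cell. -/
def P1Zero (S : Mesh F V E C) : Set (SField F) :=
  {η | η ∈ S.P1 ∧ ∀ f, ∀ t ∈ Set.Icc (0 : ℝ) 1, η f (AffineMap.lineMap (S.pt₁ f) (S.pt₀ f) t) = 0}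

/-! ### Compound elements: discrete harmonic extension into the cells -/

/-- The compound P1 space: the tangential derivative is constant along each edge, and the discrete
Laplace equation holds in each cell. -/
def V0 [Fintype F] (S : Mesh F V E C) : Set (SField F) :=
  {q | q ∈ S.P1 ∧
    (∀ e, ∃ c : ℝ, ∀ f, S.edge f = e → ∀ t ∈ Set.Icc (0 : ℝ) 1,
      inner ℝ (grad q f (AffineMap.lineMap (S.pt₁ f) (S.pt₀ f) t))
        (((S.head f : ℤ) : ℝ) • unitTangent (S.pt₁ f) (S.pt₀ f)) = c) ∧
    (∀ i, ∀ η ∈ S.P1Zero, S.cellIntegral i (fun f x => inner ℝ (grad q f x) (grad η f x)) = 0)}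

/-- The compound RT0 space: the normal component is constant along each edge; in each cell the
divergence is constant and the discrete curl vanishes. -/
def V1 [Fintype F] (S : Mesh F V E C) : Set (VField F) :=
  {u | u ∈ S.RT0 ∧
    (∀ e, ∃ c : ℝ, ∀ f, S.edge f = e → ∀ t ∈ Set.Icc (0 : ℝ) 1,
      inner ℝ (u f (AffineMap.lineMap (S.pt₁ f) (S.pt₀ f) t))
        (((S.head f : ℤ) : ℝ) • unitNormal (S.pt₁ f) (S.pt₀ f)) = c) ∧
    (∀ i, ∃ d : ℝ, ∀ f, S.cell f = i → ∀ x, div u f x = d) ∧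
    (∀ i, ∀ η ∈ S.P1Zero, S.cellIntegral i (fun f x => inner ℝ (u f x) (gradPerp η f x)) = 0)}

/-- Piecewise constants on the cells. -/
def V2 (S : Mesh F V E C) : Set (SField F) :=
  {q | ∀ i, ∃ c : ℝ, ∀ f, S.cell f = i → ∀ x, q f x = c}

/-- The dual space `V⁰`: continuous, on the dual mesh. -/
def dualV0 [Fintype F] (S : Mesh F V E C) : Set (SField F) := S.dual.V0

/-- The dual space `V¹`: `k ×` the compound RT0 space of the dual mesh. -/
def dualV1 [Fintype F] (S : Mesh F V E C) : Set (VField F) :=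
  {w | ∃ u ∈ S.dual.V1, ∀ f x, w f x = rot (u f x)}

/-- The dual space `V²`: piecewise constants on the dual cells. -/
def dualV2 (S : Mesh F V E C) : Set (SField F) := S.dual.V2

/-- The normalized basis functions of the three primal and of the three dual spaces. -/
structure Basis [Fintype F] [DecidableEq V] [DecidableEq E] [DecidableEq C]
    (S : Mesh F V E C) where
  α : C → SField F
  v : E → VField F
  γ : V → SField F
  β : V → SField F
  w : E → VField F
  χ : C → SField F
  α_mem : ∀ i, α i ∈ S.V2
  v_mem : ∀ e, v e ∈ S.V1
  γ_mem : ∀ j, γ j ∈ S.V0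
  β_mem : ∀ j, β j ∈ S.dualV2
  w_mem : ∀ e, w e ∈ S.dualV1
  χ_mem : ∀ i, χ i ∈ S.dualV0
  α_norm : ∀ i i', S.cellIntegral i' (α i) = if i = i' then 1 else 0
  v_norm : ∀ e e', S.edgeFlux e' (v e) = if e = e' then 1 else 0
  γ_norm : ∀ j j' f, S.vtx f = j' → γ j f (S.pt₀ f) = if j = j' then 1 else 0
  β_norm : ∀ j j', S.dual.cellIntegral j' (β j) = if j = j' then 1 else 0
  w_norm : ∀ e e', S.dual.edgeCirculation e' (w e) = if e = e' then 1 else 0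
  χ_norm : ∀ i i' f, S.cell f = i' → χ i f (S.pt₂ f) = if i = i' then 1 else 0

namespace Basis

variable [Fintype F] [DecidableEq V] [DecidableEq E] [DecidableEq C] {S : Mesh F V E C}

/-- Mass matrix of `V₂`. -/
def L (B : S.Basis) : Matrix C C ℝ := Matrix.of fun i i' => S.sInner (B.α i) (B.α i')

/-- Mass matrix of `V₁`. -/
def M (B : S.Basis) : Matrix E E ℝ := Matrix.of fun e e' => S.vInner (B.v e) (B.v e')

/-- Mass matrix of `V₀`. -/
def N (B : S.Basis) : Matrix V V ℝ := Matrix.of fun j j' => S.sInner (B.γ j) (B.γ j')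

/-- Discrete Hodge star `V¹ → V₁`. -/
def H (B : S.Basis) : Matrix E E ℝ := Matrix.of fun e e' => S.vInner (B.v e) (B.w e')

/-- Discrete Hodge star `V² → V₀`. -/
def J (B : S.Basis) : Matrix V V ℝ := Matrix.of fun j j' => S.sInner (B.γ j) (B.β j')

/-- Discrete Hodge star `V⁰ → V₂`. -/
def I (B : S.Basis) : Matrix C C ℝ := Matrix.of fun i i' => S.sInner (B.α i) (B.χ i')

end Basis

/-- `g ∈ V₁` is the weak gradient of `φ ∈ V₂`. -/
def IsWeakGrad [Fintype F] (S : Mesh F V E C) (φ : SField F) (g : VField F) : Prop :=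
  g ∈ S.V1 ∧ ∀ u ∈ S.V1, S.vInner u g = -S.sInner (div u) φ

/-- `ξ ∈ V₀` is the weak curl of `u ∈ V₁`. -/
def IsWeakCurl [Fintype F] (S : Mesh F V E C) (u : VField F) (ξ : SField F) : Prop :=
  ξ ∈ S.V0 ∧ ∀ ψ ∈ S.V0, S.sInner ψ ξ = -S.vInner (gradPerp ψ) u

end Mesh

end CompoundFE

end

/-!
On every facet a piecewise linear function is determined by its three corner values and a
Raviart-Thomas field by its fluxes through the three sides; `∇^⊥` maps corner values to their
differences. A divergence-free field without flux through the edges is `∇^⊥` of a combination of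
bubbles, one for each cell, and the discrete curl of the `∇^⊥` of a bubble does not vanish. Hence
the elements of `V₁` are determined by their fluxes through the edges, and every system of fluxes
occurs: the fluxes through the other sides solve a flow problem in each cell, solvable by linear
duality because the cells are connected, and bubbles then correct the discrete curl. An element of
`V₀` is a piecewise linear function whose `∇^⊥` lies in `V₁`, so it is determined by its vertex
values.

Exchanging cells and vertices is an involution of the data, under which `k ×` turns fluxes into
circulations, so the dual elements are likewise determined by their values and circulations, and the
strong derivatives are differences of vertex values and sums of fluxes. Integration by parts on the
supermesh, `⟨∇ · u, q⟩ + ⟨u, ∇q⟩ = 0` for `u` Raviart-Thomas and `q` continuous piecewise linear,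
applied to a primal `u` and a dual `q`, gives `D₁bar * I = H * D₁bar`; applied to a dual `u` and a
primal `q`, it gives `D₂bar * H = J * D₂bar`.
-/

noncomputable section

namespace CompoundFE

theorem inner_plane (a b : Plane) : inner ℝ a b = a 0 * b 0 + a 1 * b 1 := by
  simp [PiLp.inner_apply, Fin.sum_univ_two, mul_comm]

theorem plane_ext {a b : Plane} (h₀ : a 0 = b 0) (h₁ : a 1 = b 1) : a = b := by
  ext i; fin_cases i <;> assumption

@[simp] theorem rot_apply_zero (a : Plane) : rot a 0 = -(a 1) := rfl

@[simp] theorem rot_apply_one (a : Plane) : rot a 1 = a 0 := rfl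

theorem rot_add (a b : Plane) : rot (a + b) = rot a + rot b :=
  plane_ext (by simp; ring) (by simp)

theorem rot_smul (c : ℝ) (a : Plane) : rot (c • a) = c • rot a :=
  plane_ext (by simp) (by simp)

/-- Rotation by a right angle as a continuous linear map. -/
def rotL : Plane →L[ℝ] Plane :=
  LinearMap.toContinuousLinearMap { toFun := rot, map_add' := rot_add, map_smul' := rot_smul }

@[simp] theorem rotL_apply (a : Plane) : rotL a = rot a := rfl

@[simp] theorem rot_rot (a : Plane) : rot (rot a) = -a :=
  plane_ext (by simp) (by simp)

theorem inner_rot_rot (a b : Plane) : inner ℝ (rot a) (rot b) = inner ℝ a b := by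
  simp only [inner_plane, rot_apply_zero, rot_apply_one]; ring

theorem inner_rot_left (a b : Plane) : inner ℝ (rot a) b = cross a b := by
  simp only [inner_plane, cross, rot_apply_zero, rot_apply_one]; ring

theorem inner_rot_right (a b : Plane) : inner ℝ a (rot b) = -cross a b := by
  simp only [inner_plane, cross, rot_apply_zero, rot_apply_one]; ring

theorem cross_add_left (a b c : Plane) : cross (a + b) c = cross a c + cross b c := by
  simp only [cross, PiLp.add_apply]; ring

theorem cross_smul_left (t : ℝ) (a b : Plane) : cross (t • a) b = t * cross a b := by
  simp only [cross, PiLp.smul_apply, smul_eq_mul]; ring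

theorem cross_smul_right (t : ℝ) (a b : Plane) : cross a (t • b) = t * cross a b := by
  simp only [cross, PiLp.smul_apply, smul_eq_mul]; ring

theorem cross_neg_right (a b : Plane) : cross a (-b) = -cross a b := by
  simp only [cross, PiLp.neg_apply]; ring

theorem cross_self (a : Plane) : cross a a = 0 := by
  simp only [cross]; ring

theorem inner_unitNormal (a A B : Plane) :
    inner ℝ a (unitNormal A B) = (dist A B)⁻¹ * cross a (B - A) := by
  rw [unitNormal, inner_neg_right, inner_rot_right, neg_neg, unitTangent, cross_smul_right]

theorem setIntegral_affineMap_image {E G : Type*} [NormedAddCommGroup E] [NormedSpace ℝ E]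
    [FiniteDimensional ℝ E] [MeasurableSpace E] [BorelSpace E] [NormedAddCommGroup G]
    [NormedSpace ℝ G] (μ : Measure E) [μ.IsAddHaarMeasure] (T : E →ᵃ[ℝ] E)
    (hT : LinearMap.det T.linear ≠ 0) {s : Set E} (hs : MeasurableSet s) (g : E → G) :
    ∫ x in T '' s, g x ∂μ = |LinearMap.det T.linear| • ∫ x in s, g (T x) ∂μ := by
  have hderiv (x : E) : HasFDerivWithinAt T (LinearMap.toContinuousLinearMap T.linear) s x := by
    rw [T.decomp]
    exact ((LinearMap.toContinuousLinearMap T.linear).hasFDerivAt.add_const _).hasFDerivWithinAt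
  have hinj : Function.Injective T :=
    T.linear_injective_iff.mp (LinearMap.equivOfDetNeZero T.linear hT).injective
  rw [integral_image_eq_integral_abs_det_fderiv_smul μ hs (fun x _ => hderiv x) hinj.injOn,
    ← integral_smul]
  rfl

theorem eqOn_zero_of_setIntegral_eq_zero {E : Type*} [NormedAddCommGroup E] [NormedSpace ℝ E]
    [FiniteDimensional ℝ E] [MeasurableSpace E] [BorelSpace E] {μ : Measure E}
    [μ.IsAddHaarMeasure] {s : Set E} (hconv : Convex ℝ s) (hcomp : IsCompact s) (hμ : μ s ≠ 0)
    {g : E → ℝ} (hg : Continuous g) (hnonneg : ∀ x, 0 ≤ g x) (hint : ∫ x in s, g x ∂μ = 0) :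
    Set.EqOn g 0 s := by
  have hne : (interior s).Nonempty := by
    contrapose! hμ
    refine measure_mono_null (hcomp.isClosed.frontier_eq ▸ ?_) (hconv.addHaar_frontier μ)
    simp [hμ]
  rw [integral_eq_zero_iff_of_nonneg hnonneg (hg.continuousOn.integrableOn_compact hcomp)] at hint
  refine Measure.eqOn_of_ae_eq hint hg.continuousOn continuousOn_const ?_
  rw [hconv.closure_interior_eq_closure_of_nonempty_interior hne]
  exact subset_closure

/-- The closed triangle with corners `P 0`, `P 1`, `P 2`. -/
def triangle (P : Fin 3 → Plane) : Set Plane := convexHull ℝ (Set.range P)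

/-- Twice the signed area of a triangle, positive if `P 1`, `P 0`, `P 2` run counterclockwise. -/
def jac (P : Fin 3 → Plane) : ℝ := cross (P 0 - P 1) (P 2 - P 1)

/-- The affine map that takes the reference triangle with corners `(1, 0)`, `(0, 0)`, `(0, 1)` to
the triangle with corners `P`. -/
def chart (P : Fin 3 → Plane) : Plane →ᵃ[ℝ] Plane :=
  (!![(P 0 - P 1) 0, (P 2 - P 1) 0; (P 0 - P 1) 1, (P 2 - P 1) 1].toEuclideanLin).toAffineMap +
    AffineMap.const ℝ Plane (P 1)

theorem chart_apply (P : Fin 3 → Plane) (z : Plane) :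
    chart P z = z 0 • (P 0 - P 1) + z 1 • (P 2 - P 1) + P 1 := by
  apply plane_ext <;>
    simp [chart, Matrix.toLpLin_apply, dotProduct, Fin.sum_univ_two, mul_comm]

theorem det_chart (P : Fin 3 → Plane) : LinearMap.det (chart P).linear = jac P := by
  simp [chart, LinearMap.det_toLpLin, Matrix.det_fin_two, jac, cross, mul_comm]

/-- The corners of the reference triangle. -/
def refCorner : Fin 3 → Plane := ![!₂[1, 0], 0, !₂[0, 1]]

theorem triangle_eq_image_chart (P : Fin 3 → Plane) :
    triangle P = chart P '' triangle refCorner := by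
  rw [triangle, triangle, AffineMap.image_convexHull, ← Set.range_comp]
  congr 2 with k : 1
  fin_cases k <;> simp [chart_apply, refCorner]

theorem isCompact_triangle (P : Fin 3 → Plane) : IsCompact (triangle P) :=
  (Set.finite_range P).isCompact_convexHull ℝ

theorem mem_triangle_refCorner {z : Plane} :
    z ∈ triangle refCorner ↔ 0 ≤ z 0 ∧ 0 ≤ z 1 ∧ z 0 + z 1 ≤ 1 := by
  constructor
  · have hconv : Convex ℝ {z : Plane | 0 ≤ z 0 ∧ 0 ≤ z 1 ∧ z 0 + z 1 ≤ 1} := by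
      rintro x ⟨hx₀, hx₁, hx₂⟩ y ⟨hy₀, hy₁, hy₂⟩ a b ha hb hab
      simp only [Set.mem_ofPred_eq, PiLp.add_apply, PiLp.smul_apply, smul_eq_mul]
      exact ⟨by positivity, by positivity, by nlinarith⟩
    refine fun hz => convexHull_min ?_ hconv hz
    rintro _ ⟨k, rfl⟩
    fin_cases k <;> simp [refCorner]
  · rintro ⟨h₀, h₁, h₂⟩
    refine mem_convexHull_of_exists_fintype ![z 0, 1 - (z 0 + z 1), z 1] refCorner ?_ ?_
      (fun k => Set.mem_range_self k) (plane_ext ?_ ?_)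
    · intro k
      fin_cases k <;> simpa
    · simp only [Fin.sum_univ_three, Matrix.cons_val]
      ring
    all_goals simp [Fin.sum_univ_three, refCorner]

theorem setIntegral_refTriangle {g : Plane → ℝ} (hg : Continuous g) :
    ∫ z in triangle refCorner, g z = ∫ x in (0 : ℝ)..1, ∫ y in (0 : ℝ)..(1 - x), g !₂[x, y] := by
  have hmeas := (isCompact_triangle refCorner).measurableSet
  have hpres : MeasurePreserving (fun z : ℝ × ℝ => (!₂[z.1, z.2] : Plane)) volume volume :=
    (PiLp.volume_preserving_toLp (Fin 2)).comp (volume_preserving_finTwoArrow ℝ).symm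
  have hemb : MeasurableEmbedding (fun z : ℝ × ℝ => (!₂[z.1, z.2] : Plane)) :=
    (MeasurableEquiv.toLp 2 (Fin 2 → ℝ)).measurableEmbedding.comp
      MeasurableEquiv.finTwoArrow.symm.measurableEmbedding
  have hint : Integrable (fun z : ℝ × ℝ => (triangle refCorner).indicator g !₂[z.1, z.2])
      (volume.prod volume) :=
    (hpres.integrable_comp_emb hemb).mpr <| (integrable_indicator_iff hmeas).mpr
      (hg.continuousOn.integrableOn_compact (isCompact_triangle refCorner))
  have hslice (x : ℝ) : ∫ y, (triangle refCorner).indicator g !₂[x, y] =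
      (Set.Icc (0 : ℝ) 1).indicator (fun x => ∫ y in (0 : ℝ)..(1 - x), g !₂[x, y]) x := by
    by_cases hx : x ∈ Set.Icc (0 : ℝ) 1
    · have hmem (y : ℝ) : !₂[x, y] ∈ triangle refCorner ↔ y ∈ Set.Icc 0 (1 - x) := by
        simp [mem_triangle_refCorner, hx.1, le_sub_iff_add_le']
      rw [Set.indicator_of_mem hx, intervalIntegral.integral_of_le (sub_nonneg.mpr hx.2),
        ← integral_Icc_eq_integral_Ioc, ← integral_indicator measurableSet_Icc]
      simp only [Set.indicator, hmem]
    · have hnotMem (y : ℝ) : !₂[x, y] ∉ triangle refCorner := by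
        rw [mem_triangle_refCorner]
        rintro ⟨h₀, h₁, h₂⟩
        simp only [Matrix.cons_val] at h₀ h₁ h₂
        exact hx ⟨h₀, by linarith⟩
      simp only [Set.indicator_of_notMem, hx, hnotMem, not_false_iff, integral_zero]
  rw [← integral_indicator hmeas, ← hpres.integral_comp hemb, Measure.volume_eq_prod,
    integral_prod _ hint]
  simp_rw [hslice]
  rw [integral_indicator measurableSet_Icc, integral_Icc_eq_integral_Ioc,
    intervalIntegral.integral_of_le zero_le_one]

theorem integral_quadratic (c₀ c₁ c₂ r : ℝ) :
    ∫ x in (0 : ℝ)..r, (c₀ + c₁ * x + c₂ * x ^ 2) =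
      c₀ * r + c₁ * (r ^ 2 / 2) + c₂ * (r ^ 3 / 3) := by
  rw [intervalIntegral.integral_add (Continuous.intervalIntegrable (by fun_prop) _ _)
      (Continuous.intervalIntegrable (by fun_prop) _ _),
    intervalIntegral.integral_add (Continuous.intervalIntegrable (by fun_prop) _ _)
      (Continuous.intervalIntegrable (by fun_prop) _ _),
    intervalIntegral.integral_const_mul, intervalIntegral.integral_const_mul,
    intervalIntegral.integral_const, integral_id, integral_pow]
  norm_num
  ring

theorem setIntegral_triangle_affine {P : Fin 3 → Plane} (hP : jac P ≠ 0) (a : Plane) (b : ℝ) :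
    ∫ x in triangle P, (inner ℝ a x + b) =
      |jac P| / 2 * (inner ℝ a ((3 : ℝ)⁻¹ • ∑ k, P k) + b) := by
  have hchart (x y : ℝ) : inner ℝ a (chart P !₂[x, y]) + b =
      (inner ℝ a (P 0 - P 1) * x + (inner ℝ a (P 1) + b)) + inner ℝ a (P 2 - P 1) * y +
        0 * y ^ 2 := by
    simp only [chart_apply, Matrix.cons_val_zero, Matrix.cons_val_one,
      Matrix.cons_val_fin_one, inner_add_right, inner_smul_right]
    ring
  have hcont : Continuous fun z => inner ℝ a (chart P z) + b := by
    simp only [chart_apply]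
    fun_prop
  rw [triangle_eq_image_chart, setIntegral_affineMap_image volume _ (by rwa [det_chart])
    (isCompact_triangle _).measurableSet, det_chart, setIntegral_refTriangle hcont]
  simp_rw [hchart, integral_quadratic]
  set p := inner ℝ a (P 0 - P 1)
  set c := inner ℝ a (P 1) + b
  set r := inner ℝ a (P 2 - P 1)
  calc |jac P| • ∫ x in (0 : ℝ)..1,
        (p * x + c) * (1 - x) + r * ((1 - x) ^ 2 / 2) + 0 * ((1 - x) ^ 3 / 3)
      = |jac P| * ∫ x in (0 : ℝ)..1, (c + r / 2 + (p - c - r) * x + (r / 2 - p) * x ^ 2) := by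
        rw [smul_eq_mul]
        congr 2 with x
        ring
    _ = |jac P| / 2 * ((p + r) / 3 + c) := by
        rw [integral_quadratic]
        ring
    _ = _ := by
        simp only [p, c, r, inner_smul_right, inner_sub_right, inner_add_right, Fin.sum_univ_three]
        ring

theorem volume_triangle_ne_zero {P : Fin 3 → Plane} (hP : jac P ≠ 0) :
    volume (triangle P) ≠ 0 := by
  intro h
  have hint := setIntegral_triangle_affine hP 0 1
  rw [Measure.restrict_zero_set h, integral_zero_measure, inner_zero_left, zero_add, mul_one,
    eq_comm, div_eq_zero_iff] at hint
  simp [hP] at hint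

/-- The space of affine functions on the plane. -/
def affineFun : Submodule ℝ (Plane → ℝ) where
  carrier := {q | ∃ (a : Plane) (b : ℝ), ∀ x, q x = inner ℝ a x + b}
  zero_mem' := ⟨0, 0, by simp⟩
  add_mem' := by
    rintro p q ⟨a, b, hp⟩ ⟨a', b', hq⟩
    refine ⟨a + a', b + b', fun x => ?_⟩
    rw [Pi.add_apply, hp, hq, inner_add_left]
    ring
  smul_mem' := by
    rintro c q ⟨a, b, hq⟩
    refine ⟨c • a, c * b, fun x => ?_⟩
    rw [Pi.smul_apply, hq, real_inner_smul_left, smul_eq_mul, mul_add]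

/-- The lowest order Raviart-Thomas fields `x ↦ a + b x` on the plane. -/
def rtFun : Submodule ℝ (Plane → Plane) where
  carrier := {u | ∃ (a : Plane) (b : ℝ), ∀ x, u x = a + b • x}
  zero_mem' := ⟨0, 0, by simp⟩
  add_mem' := by
    rintro u w ⟨a, b, hu⟩ ⟨a', b', hw⟩
    refine ⟨a + a', b + b', fun x => ?_⟩
    rw [Pi.add_apply, hu, hw]
    module
  smul_mem' := by
    rintro c u ⟨a, b, hu⟩
    refine ⟨c • a, c * b, fun x => ?_⟩
    rw [Pi.smul_apply, hu]
    module

theorem gradient_affine {q : Plane → ℝ} {a : Plane} {b : ℝ} (hq : ∀ x, q x = inner ℝ a x + b)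
    (x : Plane) : gradient q x = a := by
  apply HasGradientAt.gradient
  rw [show q = fun x => inner ℝ a x + b from funext hq, hasGradientAt_iff_hasFDerivAt]
  exact ((InnerProductSpace.toDual ℝ Plane a).hasFDerivAt).add_const b

theorem fderiv_affine {u : Plane → Plane} {a : Plane} {b : ℝ} (hu : ∀ x, u x = a + b • x)
    (x : Plane) : fderiv ℝ u x = b • ContinuousLinearMap.id ℝ Plane := by
  rw [show u = fun x => a + b • x from funext hu]
  exact ((b • ContinuousLinearMap.id ℝ Plane).hasFDerivAt.const_add a).fderiv

theorem pdiv_affine {u : Plane → Plane} {a : Plane} {b : ℝ} (hu : ∀ x, u x = a + b • x)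
    (x : Plane) : pdiv u x = 2 * b := by
  simp [pdiv, fderiv_affine hu, two_mul]

section

variable {p q : Plane → ℝ} {u w : Plane → Plane}

theorem gradient_eq_gradient (hq : q ∈ affineFun) (x y : Plane) :
    gradient q x = gradient q y := by
  obtain ⟨a, b, hab⟩ := hq
  rw [gradient_affine hab, gradient_affine hab]

theorem gradient_add (hp : p ∈ affineFun) (hq : q ∈ affineFun) (x : Plane) :
    gradient (p + q) x = gradient p x + gradient q x := by
  obtain ⟨a, b, hab⟩ := hp
  obtain ⟨a', b', hab'⟩ := hq
  rw [gradient_affine hab, gradient_affine hab', gradient_affine (b := b + b')]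
  intro y
  rw [Pi.add_apply, hab, hab', inner_add_left]
  ring

theorem gradient_smul (hq : q ∈ affineFun) (c : ℝ) (x : Plane) :
    gradient (c • q) x = c • gradient q x := by
  obtain ⟨a, b, hab⟩ := hq
  rw [gradient_affine hab, gradient_affine (b := c * b)]
  intro y
  rw [Pi.smul_apply, hab, real_inner_smul_left, smul_eq_mul, mul_add]

theorem sub_eq_inner_gradient (hq : q ∈ affineFun) (x y z : Plane) :
    q x - q y = inner ℝ (gradient q z) (x - y) := by
  obtain ⟨a, b, hab⟩ := hq
  rw [gradient_affine hab, hab, hab, inner_sub_right]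
  ring

theorem pcurl_rot (hu : u ∈ rtFun) (x : Plane) : pcurl (fun x => rot (u x)) x = pdiv u x := by
  obtain ⟨a, b, hab⟩ := hu
  have h : HasFDerivAt (fun x => rot (u x)) (b • rotL) x := by
    rw [show (fun x => rot (u x)) = fun x => rot a + (b • rotL) x from
      funext fun x => by rw [hab, rot_add, rot_smul]; rfl]
    exact (b • rotL).hasFDerivAt.const_add _
  rw [pdiv_affine hab]
  simp [pcurl, h.fderiv, two_mul]

theorem continuous_of_mem_affineFun (hq : q ∈ affineFun) : Continuous q := by
  obtain ⟨a, b, hab⟩ := hq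
  rw [show q = fun x => inner ℝ a x + b from funext hab]
  fun_prop

theorem continuous_of_mem_rtFun (hu : u ∈ rtFun) : Continuous u := by
  obtain ⟨a, b, hab⟩ := hu
  rw [show u = fun x => a + b • x from funext hab]
  fun_prop

theorem inner_mem_affineFun (hu : u ∈ rtFun) (a : Plane) :
    (fun x => inner ℝ (u x) a) ∈ affineFun := by
  obtain ⟨c, b, hcb⟩ := hu
  refine ⟨b • a, inner ℝ c a, fun x => ?_⟩
  simp only [hcb, inner_add_left, real_inner_smul_left, real_inner_comm a x]
  ring

theorem affine_lineMap (hq : q ∈ affineFun) (A B : Plane) (t : ℝ) :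
    q (AffineMap.lineMap A B t) = (1 - t) * q A + t * q B := by
  obtain ⟨a, b, hab⟩ := hq
  simp only [hab, AffineMap.lineMap_apply_module, inner_add_right, inner_smul_right]
  ring

theorem cross_lineMap (hu : u ∈ rtFun) (A B : Plane) (t : ℝ) :
    cross (u (AffineMap.lineMap A B t)) (B - A) = cross (u A) (B - A) := by
  obtain ⟨a, b, hab⟩ := hu
  have hline : u (AffineMap.lineMap A B t) = u A + (b * t) • (B - A) := by
    rw [hab, hab, AffineMap.lineMap_apply_module]
    module
  rw [hline, cross_add_left, cross_smul_left, cross_self, mul_zero, add_zero]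

end

/-! ### Nodal and flux bases on a triangle -/

section

variable (P : Fin 3 → Plane)

/-- Gradient of the barycentric coordinate `hat P k`. -/
def hatGrad (k : Fin 3) : Plane := (jac P)⁻¹ • rot (P (k + 1) - P (k + 2))

/-- The barycentric coordinate of the corner `k`: the affine function that is `1` at this corner and
`0` at the other two. -/
def hat (k : Fin 3) (x : Plane) : ℝ := inner ℝ (hatGrad P k) (x - P (k + 1))

/-- The Raviart-Thomas field with flux `1` through the side opposite to the corner `k`, and `0`
through the other two sides. -/
def rtShape (k : Fin 3) (x : Plane) : Plane := (jac P)⁻¹ • (P k - x)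

/-- Flux of a field with constant normal component through the side opposite to the corner `k`; it
is positive for an inward flux if `jac P` is positive. -/
def sideFlux (k : Fin 3) : (Plane → Plane) →ₗ[ℝ] ℝ where
  toFun u := cross (u (P (k + 1))) (P (k + 2) - P (k + 1))
  map_add' _ _ := cross_add_left _ _ _
  map_smul' _ _ := cross_smul_left _ _ _

theorem sideFlux_apply (k : Fin 3) (u : Plane → Plane) :
    sideFlux P k u = cross (u (P (k + 1))) (P (k + 2) - P (k + 1)) := rfl

theorem hat_mem_affineFun (k : Fin 3) : hat P k ∈ affineFun :=
  ⟨hatGrad P k, -inner ℝ (hatGrad P k) (P (k + 1)), fun x => by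
    rw [hat, inner_sub_right, sub_eq_add_neg]⟩

theorem gradient_hat (k : Fin 3) (x : Plane) : gradient (hat P k) x = hatGrad P k :=
  gradient_affine (b := -inner ℝ (hatGrad P k) (P (k + 1)))
    (fun x => by rw [hat, inner_sub_right, sub_eq_add_neg]) x

theorem rtShape_mem_rtFun (k : Fin 3) : rtShape P k ∈ rtFun :=
  ⟨(jac P)⁻¹ • P k, -(jac P)⁻¹, fun x => by rw [rtShape]; module⟩

variable {P} (hP : jac P ≠ 0)
include hP

theorem hat_apply_corner (k l : Fin 3) : hat P k (P l) = (Pi.single k 1 : Fin 3 → ℝ) l := by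
  rw [hat, hatGrad, real_inner_smul_left, inner_rot_left, inv_mul_eq_iff_eq_mul₀ hP]
  fin_cases k <;> fin_cases l <;> simp [cross, jac] <;> ring

theorem hatGrad_ne_zero (k : Fin 3) : hatGrad P k ≠ 0 := by
  intro h
  have hone := hat_apply_corner hP k k
  simp [hat, h] at hone

theorem eq_sum_hat {q : Plane → ℝ} (hq : q ∈ affineFun) : q = ∑ k, q (P k) • hat P k := by
  obtain ⟨a, b, hab⟩ := hq
  funext x
  have h : jac P * q x = ∑ k, q (P k) * cross (P (k + 1) - P (k + 2)) (x - P (k + 1)) := by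
    simp [Fin.sum_univ_three, hab, inner_plane, jac, cross]
    ring
  rw [← mul_right_inj' hP, h, Finset.sum_apply, Finset.mul_sum]
  refine Finset.sum_congr rfl fun k _ => ?_
  rw [Pi.smul_apply, smul_eq_mul, hat, hatGrad, real_inner_smul_left, inner_rot_left]
  field_simp

theorem sideFlux_rtShape (k l : Fin 3) :
    sideFlux P l (rtShape P k) = (Pi.single k 1 : Fin 3 → ℝ) l := by
  rw [sideFlux_apply, rtShape, cross_smul_left, inv_mul_eq_iff_eq_mul₀ hP]
  fin_cases k <;> fin_cases l <;> simp [cross, jac] <;> ring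

theorem eq_sum_rtShape {u : Plane → Plane} (hu : u ∈ rtFun) :
    u = ∑ k, sideFlux P k u • rtShape P k := by
  obtain ⟨a, b, hab⟩ := hu
  funext x
  have h : jac P • u x = ∑ k, sideFlux P k u • (P k - x) := by
    apply plane_ext <;>
    · simp [Fin.sum_univ_three, sideFlux_apply, hab, jac, cross]
      ring
  rw [← smul_right_inj hP, h, Finset.sum_apply, Finset.smul_sum]
  refine Finset.sum_congr rfl fun k _ => ?_
  rw [Pi.smul_apply, rtShape, smul_comm, smul_inv_smul₀ hP]

theorem pdiv_eq_sum_sideFlux {u : Plane → Plane} (hu : u ∈ rtFun) (x : Plane) :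
    pdiv u x = -2 * (jac P)⁻¹ * ∑ k, sideFlux P k u := by
  obtain ⟨a, b, hab⟩ := hu
  have h : ∑ k, sideFlux P k u = -(jac P * b) := by
    simp [Fin.sum_univ_three, sideFlux_apply, hab, jac, cross]
    ring
  rw [pdiv_affine hab, h]
  field_simp

end

theorem sideFlux_rot_gradient (P : Fin 3 → Plane) (k : Fin 3) {q : Plane → ℝ}
    (hq : q ∈ affineFun) :
    sideFlux P k (fun x => rot (gradient q x)) = q (P (k + 1)) - q (P (k + 2)) := by
  rw [sideFlux_apply, ← inner_rot_left, rot_rot, inner_neg_left, ← sub_eq_inner_gradient hq,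
    neg_sub]

/-- The barycentre of a triangle. -/
def centroid (P : Fin 3 → Plane) : Plane := (3 : ℝ)⁻¹ • ∑ k, P k

section

variable {P : Fin 3 → Plane} (hP : jac P ≠ 0)
include hP

theorem setIntegral_triangle {q : Plane → ℝ} (hq : q ∈ affineFun) :
    ∫ x in triangle P, q x = |jac P| / 2 * q (centroid P) := by
  obtain ⟨a, b, hab⟩ := hq
  simp_rw [hab]
  exact setIntegral_triangle_affine hP a b

theorem setIntegral_pdiv_mul_add_setIntegral_inner {u : Plane → Plane} (hu : u ∈ rtFun)
    {q : Plane → ℝ} (hq : q ∈ affineFun) :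
    (∫ x in triangle P, pdiv u x * q x) + ∫ x in triangle P, inner ℝ (u x) (gradient q x) =
      -(|jac P| / jac P) * ∑ k, sideFlux P k u * ((q (P (k + 1)) + q (P (k + 2))) / 2) := by
  set c := centroid P
  have hcentroid : 3 * q c = ∑ k, q (P k) := by
    obtain ⟨a, b, hab⟩ := hq
    simp only [hab, Finset.sum_add_distrib, ← inner_sum, c, centroid, inner_smul_right,
      Fin.sum_univ_three]
    ring
  have hinner : inner ℝ (u c) (gradient q c) =
      (jac P)⁻¹ * ∑ k, sideFlux P k u * (q (P k) - q c) := by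
    rw [eq_sum_rtShape hP hu, Finset.sum_apply, sum_inner, Finset.mul_sum]
    refine Finset.sum_congr rfl fun k _ => ?_
    rw [Pi.smul_apply, rtShape, real_inner_smul_left, real_inner_smul_left,
      sub_eq_inner_gradient hq _ _ c, real_inner_comm, ← eq_sum_rtShape hP hu]
    ring
  simp_rw [pdiv_eq_sum_sideFlux hP hu, gradient_eq_gradient hq _ c]
  rw [integral_const_mul, setIntegral_triangle hP hq,
    setIntegral_triangle hP (inner_mem_affineFun hu (gradient q c)), hinner]
  simp only [Fin.sum_univ_three, Fin.reduceAdd] at hcentroid ⊢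
  linear_combination (-|jac P| / jac P / 2 *
    (sideFlux P 0 u + sideFlux P 1 u + sideFlux P 2 u)) * hcentroid

end

theorem sum_eq_zero_of_antisymm {F R : Type*} [Fintype F] [AddCommGroup R] [IsAddTorsionFree R]
    {ρ : F → F} (hρ : Function.Involutive ρ) {r : F → R} (hr : ∀ f, r (ρ f) = -r f) :
    ∑ f, r f = 0 := by
  rw [← self_eq_neg, ← Finset.sum_neg_distrib]
  simp_rw [← hr]
  exact (Equiv.sum_comp hρ.toPerm r).symm

theorem sum_comp_of_involutive {F R : Type*} [Fintype F] [AddCommMonoid R] {ρ : F → F}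
    (hρ : Function.Involutive ρ) (r : F → R) : ∑ f, r (ρ f) = ∑ f, r f :=
  Equiv.sum_comp hρ.toPerm r

theorem contAcross_iff {F : Type*} {q : SField F} (hq : ∀ f, q f ∈ affineFun) (ρ : F → F)
    (A B : F → Plane) :
    Mesh.ContAcross ρ A B q ↔
      (∀ f, q (ρ f) (A (ρ f)) = q f (A f)) ∧ ∀ f, q (ρ f) (B (ρ f)) = q f (B f) := by
  constructor
  · intro h
    exact ⟨fun f => by simpa using h f 0 (by simp), fun f => by simpa using h f 1 (by simp)⟩
  · rintro ⟨hA, hB⟩ f t -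
    rw [affine_lineMap (hq _), affine_lineMap (hq f), hA, hB]

theorem normalContAcross_iff {F : Type*} {u : VField F} (hu : ∀ f, u f ∈ rtFun) {ρ : F → F}
    {A B : F → Plane} (hdist : ∀ f, dist (A (ρ f)) (B (ρ f)) = dist (A f) (B f))
    (hne : ∀ f, A f ≠ B f) :
    Mesh.NormalContAcross ρ A B u ↔
      ∀ f, cross (u (ρ f) (A (ρ f))) (B (ρ f) - A (ρ f)) = cross (u f (A f)) (B f - A f) := by
  have hinv (f : F) : (dist (A f) (B f))⁻¹ ≠ 0 := inv_ne_zero (dist_ne_zero.mpr (hne f))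
  simp only [Mesh.NormalContAcross, inner_unitNormal, cross_lineMap (hu _), hdist]
  refine forall_congr' fun f => ⟨fun h => mul_left_cancel₀ (hinv f) (h 0 (by simp)), ?_⟩
  rintro h - -
  rw [h]

namespace Mesh

/-! ### Corners, sides and signs of the facets -/

section

variable {F V E C : Type*} (S : Mesh F V E C)

/-- The corners of a facet, numbered like `pt₀`, `pt₁`, `pt₂`. -/
def corner (f : F) : Fin 3 → Plane := ![S.pt₀ f, S.pt₁ f, S.pt₂ f]

/-- The neighbour of a facet across the side opposite to the corner `k`. -/
def nbr (k : Fin 3) : F → F := ![S.ρ₀, S.ρ₁, S.ρ₂] k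

/-- The sign `sgn` as a real number. -/
def sg (f : F) : ℝ := ((S.sgn f : ℤ) : ℝ)

/-- The sign `head` as a real number. -/
def hd (f : F) : ℝ := ((S.head f : ℤ) : ℝ)

/-- The area of a facet. -/
def area (f : F) : ℝ := |jac (S.corner f)| / 2

/-- The length of the part of a primal edge that bounds the facet. -/
def len (f : F) : ℝ := dist (S.pt₁ f) (S.pt₀ f)

theorem nbr_involutive (k : Fin 3) : Function.Involutive (S.nbr k) := by
  fin_cases k
  exacts [S.ρ₀_invol, S.ρ₁_invol, S.ρ₂_invol]

theorem sg_nbr (k : Fin 3) (f : F) : S.sg (S.nbr k f) = -S.sg f := by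
  fin_cases k <;> simp [sg, nbr, S.sgn_ρ₀, S.sgn_ρ₁, S.sgn_ρ₂]

theorem sg_ρ₂ (f : F) : S.sg (S.ρ₂ f) = -S.sg f := S.sg_nbr 2 f

theorem hd_ρ₀ (f : F) : S.hd (S.ρ₀ f) = -S.hd f := by simp [hd, S.head_ρ₀]

theorem hd_ρ₂ (f : F) : S.hd (S.ρ₂ f) = S.hd f := by simp [hd, S.head_ρ₂]

theorem sg_mul_self (f : F) : S.sg f * S.sg f = 1 := by
  rcases Int.units_eq_one_or (S.sgn f) with h | h <;> simp [sg, h]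

theorem hd_mul_self (f : F) : S.hd f * S.hd f = 1 := by
  rcases Int.units_eq_one_or (S.head f) with h | h <;> simp [hd, h]

theorem sg_mul_jac_pos (f : F) : 0 < S.sg f * jac (S.corner f) := S.oriented f

theorem jac_ne_zero (f : F) : jac (S.corner f) ≠ 0 := right_ne_zero_of_mul (S.sg_mul_jac_pos f).ne'

theorem area_pos (f : F) : 0 < S.area f := by
  have := abs_pos.mpr (S.jac_ne_zero f)
  unfold area
  positivity

theorem abs_jac_div_jac (f : F) : |jac (S.corner f)| / jac (S.corner f) = S.sg f := by
  have hpos := S.sg_mul_jac_pos f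
  rw [div_eq_iff (S.jac_ne_zero f)]
  rcases Int.units_eq_one_or (S.sgn f) with h | h <;>
    simp only [sg, h, Units.val_neg, Units.val_one, Int.cast_neg, Int.cast_one, neg_mul,
      one_mul, neg_pos] at hpos ⊢
  · exact abs_of_pos hpos
  · exact abs_of_neg hpos

theorem inv_jac (f : F) : (jac (S.corner f))⁻¹ = S.sg f / (2 * S.area f) := by
  have hjac : |jac (S.corner f)| ≠ 0 := abs_ne_zero.mpr (S.jac_ne_zero f)
  rw [← S.abs_jac_div_jac, area]
  field_simp

theorem corner_injective (f : F) : Function.Injective (S.corner f) := by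
  have hjac := S.jac_ne_zero f
  contrapose! hjac
  rw [Function.not_injective_iff] at hjac
  obtain ⟨k, l, hkl, hne⟩ := hjac
  unfold jac
  fin_cases k <;> fin_cases l <;> simp_all [cross] <;> ring

theorem len_pos (f : F) : 0 < S.len f :=
  dist_pos.mpr ((S.corner_injective f).ne (a₁ := 1) (a₂ := 0) (by decide))

theorem len_ρ₂ (f : F) : S.len (S.ρ₂ f) = S.len f := by
  rw [len, len, dist_comm, S.glue_ρ₂, dist_comm]

theorem tri_eq_triangle (f : F) : S.tri f = triangle (S.corner f) := by
  rw [tri, triangle, corner, Matrix.range_cons, Matrix.range_cons, Matrix.range_cons_empty]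
  rfl

/-! ### Nodal values and fluxes -/

/-- Value of a scalar field at the corner `k` of a facet. -/
def nodal (k : Fin 3) : SField F →ₗ[ℝ] F → ℝ where
  toFun q f := q f (S.corner f k)
  map_add' _ _ := rfl
  map_smul' _ _ := rfl

/-- Flux of a vector field through the side of a facet opposite to the corner `k`. -/
def flux (k : Fin 3) : VField F →ₗ[ℝ] F → ℝ where
  toFun u f := sideFlux (S.corner f) k (u f)
  map_add' _ _ := funext fun _ => (sideFlux _ k).map_add _ _
  map_smul' _ _ := funext fun _ => (sideFlux _ k).map_smul _ _

variable {S}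

theorem mem_P1_iff {q : SField F} :
    q ∈ S.P1 ↔ (∀ f, q f ∈ affineFun) ∧
      ∀ k l, k ≠ l → ∀ f, S.nodal k q (S.nbr l f) = S.nodal k q f := by
  refine and_congr_right fun hq => ?_
  rw [contAcross_iff hq, contAcross_iff hq, contAcross_iff hq]
  simp only [nodal, nbr, corner, LinearMap.coe_mk, AddHom.coe_mk, Fin.forall_fin_succ,
    cons_val_zero, cons_val_succ, cons_val_fin_one, IsEmpty.forall_iff, and_true,
    Fin.succ_zero_eq_one, Fin.succ_one_eq_two, ne_eq, not_true_eq_false, Fin.reduceEq,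
    not_false_eq_true, forall_const, true_and, zero_ne_one]
  tauto

theorem mem_RT0_iff {u : VField F} :
    u ∈ S.RT0 ↔ (∀ f, u f ∈ rtFun) ∧ ∀ k f, S.flux k u (S.nbr k f) = S.flux k u f := by
  refine and_congr_right fun hu => ?_
  have hne (k l) (hkl : k ≠ l) (f : F) : S.corner f k ≠ S.corner f l :=
    (S.corner_injective f).ne hkl
  rw [normalContAcross_iff hu S.glue_ρ₀ (hne 1 2 (by decide)),
    normalContAcross_iff hu S.glue_ρ₁ (hne 0 2 (by decide)),
    normalContAcross_iff hu S.glue_ρ₂ (hne 0 1 (by decide))]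
  have hflux (f : F) : S.flux 1 u f = -cross (u f (S.pt₀ f)) (S.pt₂ f - S.pt₀ f) := by
    rw [← cross_lineMap (hu f) _ _ 1, AffineMap.lineMap_apply_one, ← cross_neg_right, neg_sub]
    rfl
  simp only [Fin.forall_fin_succ, Fin.succ_zero_eq_one, Fin.succ_one_eq_two, hflux, neg_inj]
  simp [flux, nbr, corner, sideFlux_apply]

variable (S) in
/-- The continuous piecewise linear elements as a vector space. -/
def P1Space : Submodule ℝ (SField F) where
  carrier := S.P1
  zero_mem' := mem_P1_iff.mpr ⟨fun _ => zero_mem _, fun _ _ _ _ => by rw [map_zero]; rfl⟩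
  add_mem' {p q} hp hq := by
    rw [mem_P1_iff] at hp hq ⊢
    refine ⟨fun f => add_mem (hp.1 f) (hq.1 f), fun k l hkl f => ?_⟩
    rw [map_add, Pi.add_apply, Pi.add_apply, hp.2 k l hkl, hq.2 k l hkl]
  smul_mem' c q hq := by
    rw [mem_P1_iff] at hq ⊢
    refine ⟨fun f => Submodule.smul_mem _ c (hq.1 f), fun k l hkl f => ?_⟩
    rw [map_smul, Pi.smul_apply, Pi.smul_apply, hq.2 k l hkl]

variable (S) in
/-- The lowest order Raviart-Thomas elements as a vector space. -/
def RT0Space : Submodule ℝ (VField F) where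
  carrier := S.RT0
  zero_mem' := mem_RT0_iff.mpr ⟨fun _ => zero_mem _, fun _ _ => by rw [map_zero]; rfl⟩
  add_mem' {u w} hu hw := by
    rw [mem_RT0_iff] at hu hw ⊢
    refine ⟨fun f => add_mem (hu.1 f) (hw.1 f), fun k f => ?_⟩
    rw [map_add, Pi.add_apply, Pi.add_apply, hu.2, hw.2]
  smul_mem' c u hu := by
    rw [mem_RT0_iff] at hu ⊢
    refine ⟨fun f => Submodule.smul_mem _ c (hu.1 f), fun k f => ?_⟩
    rw [map_smul, Pi.smul_apply, Pi.smul_apply, hu.2]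

theorem exists_mem_P1 {c : Fin 3 → F → ℝ} (hc : ∀ k l, k ≠ l → ∀ f, c k (S.nbr l f) = c k f) :
    ∃ q ∈ S.P1, ∀ k, S.nodal k q = c k := by
  have hnodal (k) : S.nodal k (fun f => ∑ l, c l f • hat (S.corner f) l) = c k := by
    funext f
    simp [nodal, hat_apply_corner (S.jac_ne_zero f), Pi.single_apply]
  refine ⟨_, mem_P1_iff.mpr ⟨fun f => ?_, fun k l hkl f => ?_⟩, hnodal⟩
  · exact sum_mem fun l _ => Submodule.smul_mem _ _ (hat_mem_affineFun _ l)
  · rw [hnodal, hc k l hkl]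

theorem eq_of_nodal_eq {p q : SField F} (hp : p ∈ S.P1) (hq : q ∈ S.P1)
    (h : ∀ k, S.nodal k p = S.nodal k q) : p = q := by
  funext f
  rw [eq_sum_hat (S.jac_ne_zero f) ((mem_P1_iff.mp hp).1 f),
    eq_sum_hat (S.jac_ne_zero f) ((mem_P1_iff.mp hq).1 f)]
  exact Finset.sum_congr rfl fun k _ => congrArg (· • _) (congrFun (h k) f)

theorem exists_mem_RT0 {s : Fin 3 → F → ℝ} (hs : ∀ k f, s k (S.nbr k f) = s k f) :
    ∃ u ∈ S.RT0, ∀ k, S.flux k u = s k := by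
  have hflux (k) : S.flux k (fun f => ∑ l, s l f • rtShape (S.corner f) l) = s k := by
    funext f
    simp [flux, sideFlux_rtShape (S.jac_ne_zero f), Pi.single_apply]
  refine ⟨_, mem_RT0_iff.mpr ⟨fun f => ?_, fun k f => ?_⟩, hflux⟩
  · exact sum_mem fun l _ => Submodule.smul_mem _ _ (rtShape_mem_rtFun _ l)
  · rw [hflux, hs]

theorem eq_of_flux_eq {u w : VField F} (hu : u ∈ S.RT0) (hw : w ∈ S.RT0)
    (h : ∀ k, S.flux k u = S.flux k w) : u = w := by
  funext f
  rw [eq_sum_rtShape (S.jac_ne_zero f) ((mem_RT0_iff.mp hu).1 f),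
    eq_sum_rtShape (S.jac_ne_zero f) ((mem_RT0_iff.mp hw).1 f)]
  exact Finset.sum_congr rfl fun k _ => congrArg (· • _) (congrFun (h k) f)

theorem flux_gradPerp {q : SField F} (hq : q ∈ S.P1) (k : Fin 3) (f : F) :
    S.flux k (gradPerp q) f = S.nodal (k + 1) q f - S.nodal (k + 2) q f :=
  sideFlux_rot_gradient _ k ((mem_P1_iff.mp hq).1 f)

theorem gradPerp_mem_RT0 {q : SField F} (hq : q ∈ S.P1) : gradPerp q ∈ S.RT0 := by
  refine mem_RT0_iff.mpr ⟨fun f => ?_, fun k f => ?_⟩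
  · obtain ⟨a, b, hab⟩ := (mem_P1_iff.mp hq).1 f
    refine ⟨rot a, 0, fun x => ?_⟩
    rw [gradPerp, grad, gradient_affine hab, zero_smul, add_zero]
  · rw [flux_gradPerp hq, flux_gradPerp hq, (mem_P1_iff.mp hq).2 _ _ (by simp),
      (mem_P1_iff.mp hq).2 _ _ (by simp)]

theorem div_apply {u : VField F} (hu : u ∈ S.RT0) (f : F) (x : Plane) :
    div u f x = -(S.area f)⁻¹ * ∑ k, S.sg f * S.flux k u f := by
  rw [div, pdiv_eq_sum_sideFlux (S.jac_ne_zero f) ((mem_RT0_iff.mp hu).1 f), S.inv_jac,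
    ← Finset.mul_sum]
  simp only [flux, LinearMap.coe_mk, AddHom.coe_mk]
  field_simp

theorem div_gradPerp {q : SField F} (hq : q ∈ S.P1) : div (gradPerp q) = 0 := by
  funext f x
  simp only [div_apply (gradPerp_mem_RT0 hq), flux_gradPerp hq, Fin.sum_univ_three, Fin.reduceAdd,
    Pi.zero_apply]
  ring

section

variable [Fintype F]

theorem sum_mul_sg_mul_flux {u : VField F} (hu : u ∈ S.RT0) {k : Fin 3} {χ : F → ℝ}
    (hχ : ∀ f, χ (S.nbr k f) = χ f) : ∑ f, χ f * (S.sg f * S.flux k u f) = 0 :=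
  sum_eq_zero_of_antisymm (S.nbr_involutive k) fun f => by
    rw [hχ, S.sg_nbr, (mem_RT0_iff.mp hu).2]
    ring

theorem sInner_div_add_vInner_grad {u : VField F} (hu : u ∈ S.RT0) {q : SField F}
    (hq : q ∈ S.P1) : S.sInner (div u) q + S.vInner u (grad q) = 0 := by
  rw [mem_P1_iff] at hq
  simp only [sInner, vInner, ← Finset.sum_add_distrib, tri_eq_triangle, div, grad]
  calc _ = ∑ f, -∑ k, (S.nodal (k + 1) q f + S.nodal (k + 2) q f) / 2 *
        (S.sg f * S.flux k u f) := by
        refine Finset.sum_congr rfl fun f _ => ?_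
        rw [setIntegral_pdiv_mul_add_setIntegral_inner (S.jac_ne_zero f)
          ((mem_RT0_iff.mp hu).1 f) (hq.1 f), S.abs_jac_div_jac, neg_mul, Finset.mul_sum]
        refine congrArg _ (Finset.sum_congr rfl fun k _ => ?_)
        simp only [nodal, flux, LinearMap.coe_mk, AddHom.coe_mk]
        ring
    _ = -∑ k, ∑ f, (S.nodal (k + 1) q f + S.nodal (k + 2) q f) / 2 *
        (S.sg f * S.flux k u f) := by
        rw [Finset.sum_neg_distrib, Finset.sum_comm]
    _ = 0 := by
        rw [neg_eq_zero]
        refine Finset.sum_eq_zero fun k _ => sum_mul_sg_mul_flux hu fun f => ?_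
        rw [hq.2 _ _ (by simp), hq.2 _ _ (by simp)]

end

end

/-! ### Functions of vertices, edges and cells -/

section

variable {F V E C : Type*} (S : Mesh F V E C)

theorem vtx_ρ₁ (f : F) : S.vtx (S.ρ₁ f) = S.vtx f :=
  ((S.vtx_eq_iff _ _).mpr (.single (Or.inl rfl))).symm

theorem vtx_ρ₂ (f : F) : S.vtx (S.ρ₂ f) = S.vtx f :=
  ((S.vtx_eq_iff _ _).mpr (.single (Or.inr rfl))).symm

theorem cell_ρ₁ (f : F) : S.cell (S.ρ₁ f) = S.cell f := S.dual.vtx_ρ₁ f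

theorem cell_ρ₀ (f : F) : S.cell (S.ρ₀ f) = S.cell f := S.dual.vtx_ρ₂ f

theorem edge_ρ₀ (f : F) : S.edge (S.ρ₀ f) = S.edge f :=
  ((S.edge_eq_iff _ _).mpr (by simp)).symm

theorem edge_ρ₂ (f : F) : S.edge (S.ρ₂ f) = S.edge f := S.dual.edge_ρ₀ f

theorem factorsThrough_vtx {X : Type*} {h : F → X} (h₁ : ∀ f, h (S.ρ₁ f) = h f)
    (h₂ : ∀ f, h (S.ρ₂ f) = h f) : h.FactorsThrough S.vtx := by
  intro f g hfg
  have hpath := (S.vtx_eq_iff f g).mp hfg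
  clear hfg
  induction hpath with
  | refl => rfl
  | tail _ hbc ih => rcases hbc with rfl | rfl <;> simp [ih, h₁, h₂]

theorem factorsThrough_cell {X : Type*} {h : F → X} (h₁ : ∀ f, h (S.ρ₁ f) = h f)
    (h₀ : ∀ f, h (S.ρ₀ f) = h f) : h.FactorsThrough S.cell :=
  S.dual.factorsThrough_vtx h₁ h₀

/-! ### Cell bubbles -/

/-- The piecewise linear function with value `κ i` at the centre of the cell `i` that vanishes on
the edges of the mesh. -/
def bubble (κ : C → ℝ) : SField F := fun f => κ (S.cell f) • hat (S.corner f) 2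

variable {S}

theorem nodal_bubble (κ : C → ℝ) (k : Fin 3) (f : F) :
    S.nodal k (S.bubble κ) f = κ (S.cell f) * (Pi.single 2 1 : Fin 3 → ℝ) k :=
  congrArg (κ (S.cell f) * ·) (hat_apply_corner (S.jac_ne_zero f) 2 k)

theorem bubble_mem_P1 (κ : C → ℝ) : S.bubble κ ∈ S.P1 := by
  refine mem_P1_iff.mpr ⟨fun f => Submodule.smul_mem _ _ (hat_mem_affineFun _ _), ?_⟩
  intro k l hkl f
  rw [nodal_bubble, nodal_bubble]
  match l, hkl with
  | 0, _ => rw [show S.nbr 0 f = S.ρ₀ f from rfl, cell_ρ₀]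
  | 1, _ => rw [show S.nbr 1 f = S.ρ₁ f from rfl, cell_ρ₁]
  | 2, hkl => rw [Pi.single_eq_of_ne hkl, mul_zero, mul_zero]

theorem mem_P1Zero_iff {η : SField F} : η ∈ S.P1Zero ↔ ∃ κ, S.bubble κ = η := by
  constructor
  · rintro ⟨hη, hzero⟩
    have h₀ (f) : S.nodal 0 η f = 0 := by
      have := hzero f 1 (by simp)
      rwa [AffineMap.lineMap_apply_one] at this
    have h₁ (f) : S.nodal 1 η f = 0 := by
      have := hzero f 0 (by simp)
      rwa [AffineMap.lineMap_apply_zero] at this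
    have h₂ : (S.nodal 2 η).FactorsThrough S.cell :=
      S.factorsThrough_cell ((mem_P1_iff.mp hη).2 2 1 (by decide))
        ((mem_P1_iff.mp hη).2 2 0 (by decide))
    obtain ⟨κ, hκ⟩ := (Function.factorsThrough_iff _).mp h₂
    refine ⟨κ, eq_of_nodal_eq (bubble_mem_P1 κ) hη fun k => funext fun f => ?_⟩
    rw [nodal_bubble]
    fin_cases k
    · simp [h₀]
    · simp [h₁]
    · simp [hκ]
  · rintro ⟨κ, rfl⟩
    refine ⟨bubble_mem_P1 κ, fun f t _ => ?_⟩
    have h (k) (hk : k ≠ 2) : S.bubble κ f (S.corner f k) = 0 := by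
      rw [show S.bubble κ f _ = _ from nodal_bubble κ k f, Pi.single_eq_of_ne hk, mul_zero]
    rw [affine_lineMap ((mem_P1_iff.mp (bubble_mem_P1 κ)).1 f), show S.bubble κ f (S.pt₁ f) = 0 from
      h 1 (by decide), show S.bubble κ f (S.pt₀ f) = 0 from h 0 (by decide), mul_zero, mul_zero,
      add_zero]

theorem gradPerp_bubble (κ : C → ℝ) (f : F) (x : Plane) :
    gradPerp (S.bubble κ) f x = κ (S.cell f) • rot (hatGrad (S.corner f) 2) := by
  rw [gradPerp, grad, bubble, gradient_smul (hat_mem_affineFun _ _), gradient_hat, rot_smul]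

variable [Fintype F] (S)

open Classical in
/-- The area of a cell. -/
def cellArea (i : C) : ℝ := ∑ f with S.cell f = i, S.area f

open Classical in
/-- The discrete curl of a field in a cell, that is, the integral of its inner product with the
rotated gradient of the bubble of the cell. -/
def cellMoment (i : C) : VField F →ₗ[ℝ] ℝ where
  toFun u := ∑ f with S.cell f = i,
    S.area f * inner ℝ (u f (centroid (S.corner f))) (rot (hatGrad (S.corner f) 2))
  map_add' u w := by
    simp only [Pi.add_apply, inner_add_left, mul_add, Finset.sum_add_distrib]
  map_smul' c u := by
    simp only [Pi.smul_apply, real_inner_smul_left, RingHom.id_apply, smul_eq_mul, Finset.mul_sum,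
      mul_left_comm]

open Classical in
theorem sum_cell_pos {h : F → ℝ} (hpos : ∀ f, 0 < h f) (i : C) :
    0 < ∑ f with S.cell f = i, h f := by
  obtain ⟨f, hf⟩ := S.cell_surj i
  exact Finset.sum_pos (fun f _ => hpos f) ⟨f, by simp [hf]⟩

theorem cellArea_pos (i : C) : 0 < S.cellArea i := S.sum_cell_pos S.area_pos i

theorem cellMoment_gradPerp_bubble (κ : C → ℝ) (i : C) :
    S.cellMoment i (gradPerp (S.bubble κ)) = κ i * S.cellMoment i (gradPerp (S.bubble 1)) := by
  classical
  simp only [cellMoment, LinearMap.coe_mk, AddHom.coe_mk, gradPerp_bubble, Finset.mul_sum]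
  refine Finset.sum_congr rfl fun f hf => ?_
  rw [(Finset.mem_filter.mp hf).2, real_inner_smul_left, Pi.one_apply, one_smul, mul_left_comm]

theorem cellMoment_gradPerp_bubble_pos (i : C) :
    0 < S.cellMoment i (gradPerp (S.bubble 1)) := by
  simp only [cellMoment, LinearMap.coe_mk, AddHom.coe_mk, gradPerp_bubble, Pi.one_apply, one_smul,
    inner_rot_rot]
  exact S.sum_cell_pos (fun f => mul_pos (S.area_pos f)
    (real_inner_self_pos.mpr (hatGrad_ne_zero (S.jac_ne_zero f) 2))) i

theorem exists_cellMoment_gradPerp_bubble_eq (m : C → ℝ) :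
    ∃ κ, ∀ i, S.cellMoment i (gradPerp (S.bubble κ)) = m i :=
  ⟨fun i => m i / S.cellMoment i (gradPerp (S.bubble 1)), fun i => by
    rw [cellMoment_gradPerp_bubble, div_mul_cancel₀ _ (S.cellMoment_gradPerp_bubble_pos i).ne']⟩

variable {S}

theorem cellIntegral_inner_gradPerp_bubble {u : VField F} (hu : ∀ f, u f ∈ rtFun) (κ : C → ℝ)
    (i : C) : S.cellIntegral i (fun f x => inner ℝ (u f x) (gradPerp (S.bubble κ) f x)) =
      κ i * S.cellMoment i u := by
  classical
  simp only [cellIntegral, cellMoment, LinearMap.coe_mk, AddHom.coe_mk, gradPerp_bubble,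
    inner_smul_right, Finset.mul_sum]
  refine Finset.sum_congr rfl fun f hf => ?_
  rw [(Finset.mem_filter.mp hf).2, integral_const_mul, tri_eq_triangle,
    setIntegral_triangle (S.jac_ne_zero f) (inner_mem_affineFun (hu f) _), area]

theorem forall_cellIntegral_gradPerp_eq_zero_iff {u : VField F} (hu : ∀ f, u f ∈ rtFun) (i : C) :
    (∀ η ∈ S.P1Zero, S.cellIntegral i (fun f x => inner ℝ (u f x) (gradPerp η f x)) = 0) ↔
      S.cellMoment i u = 0 := by
  simp only [mem_P1Zero_iff, forall_exists_index, forall_apply_eq_imp_iff,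
    cellIntegral_inner_gradPerp_bubble hu]
  exact ⟨fun h => by simpa using h 1, fun h κ => by rw [h, mul_zero]⟩

end

/-! ### Incidence matrices, fluxes and circulations -/

section

variable {F V E C : Type*} (S : Mesh F V E C)

theorem dual_hd (f : F) : S.dual.hd f = -(S.sg f * S.hd f) := by
  simp [hd, sg, dual]

theorem dual_side (f : F) : S.dual.side f = S.head f := by
  change -S.sgn f * -(S.sgn f * S.head f) = _
  rw [neg_mul_neg, ← mul_assoc, Int.units_mul_self, one_mul]

theorem side_ρ₂ (f : F) : S.side (S.ρ₂ f) = -S.side f := by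
  simp [side, S.sgn_ρ₂, S.head_ρ₂]

theorem head_eq_of_edge_eq_of_vtx_eq {f g : F} (he : S.edge f = S.edge g)
    (hv : S.vtx f = S.vtx g) : S.head f = S.head g := by
  rcases (S.edge_eq_iff f g).mp he with rfl | rfl | rfl | rfl
  · rfl
  · exact absurd hv.symm (S.vtx_ne f)
  · exact (S.head_ρ₂ f).symm
  · rw [← S.vtx_ρ₂ f] at hv
    exact absurd hv.symm (S.vtx_ne _)

theorem vtx_eq_or_of_edge_eq {f g : F} (he : S.edge g = S.edge f) :
    S.vtx g = S.vtx f ∨ S.vtx g = S.vtx (S.ρ₀ f) := by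
  rcases (S.edge_eq_iff f g).mp he.symm with rfl | rfl | rfl | rfl
  · exact Or.inl rfl
  · exact Or.inr rfl
  · exact Or.inl (S.vtx_ρ₂ f)
  · exact Or.inr (by rw [S.ρ_comm, vtx_ρ₂])

theorem D₁_edge_vtx (f : F) : S.D₁ (S.edge f) (S.vtx f) = S.hd f := by
  have h (ε : ℤˣ) : (∃ g, S.edge g = S.edge f ∧ S.vtx g = S.vtx f ∧ S.head g = ε) ↔
      S.head f = ε := by
    constructor
    · rintro ⟨g, he, hv, rfl⟩
      exact (S.head_eq_of_edge_eq_of_vtx_eq he hv).symm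
    · exact fun hf => ⟨f, rfl, rfl, hf⟩
  simp only [D₁, Matrix.of_apply, h, hd]
  rcases Int.units_eq_one_or (S.head f) with hf | hf <;> simp [hf]

theorem D₁_edge_apply [DecidableEq V] (f : F) (j : V) : S.D₁ (S.edge f) j =
    S.hd f * ((if S.vtx f = j then 1 else 0) - if S.vtx (S.ρ₀ f) = j then 1 else 0) := by
  by_cases hj : S.vtx f = j
  · subst hj
    rw [D₁_edge_vtx, if_pos rfl, if_neg (S.vtx_ne f), sub_zero, mul_one]
  by_cases hj' : S.vtx (S.ρ₀ f) = j
  · subst hj'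
    rw [← edge_ρ₀, D₁_edge_vtx, if_neg hj, if_pos rfl, hd_ρ₀, zero_sub, mul_neg, mul_one]
  have h (ε : ℤˣ) : ¬∃ g, S.edge g = S.edge f ∧ S.vtx g = j ∧ S.head g = ε := by
    rintro ⟨g, he, rfl, -⟩
    exact (S.vtx_eq_or_of_edge_eq he).elim (fun h => hj h.symm) fun h => hj' h.symm
  simp [D₁, h, hj, hj']

theorem D₁_mulVec_edge [Fintype V] (κ : V → ℝ) (f : F) :
    (S.D₁ *ᵥ κ) (S.edge f) = S.hd f * (κ (S.vtx f) - κ (S.vtx (S.ρ₀ f))) := by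
  classical
  simp only [mulVec, dotProduct, D₁_edge_apply, mul_assoc, ← Finset.mul_sum, sub_mul, ite_mul,
    one_mul, zero_mul, Finset.sum_sub_distrib, Finset.sum_ite_eq, Finset.mem_univ, if_true]

theorem D₂bar_eq_dual_D₂ : S.D₂bar = S.dual.D₂ := by
  have hside : S.dual.side = S.head := funext S.dual_side
  rw [D₂, hside]
  rfl

theorem D₁bar_eq_dual_D₁ : S.D₁bar = S.dual.D₁ := by
  ext e i
  have hexcl (h : ∃ f, S.edge f = e ∧ S.cell f = i ∧ S.side f = 1) :
      ¬∃ f, S.edge f = e ∧ S.cell f = i ∧ S.side f = -1 := by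
    rintro ⟨g, rfl, rfl, hg⟩
    obtain ⟨f, he, hc, hf⟩ := h
    have := S.dual.head_eq_of_edge_eq_of_vtx_eq he hc
    change -S.side f = -S.side g at this
    simp [hf, hg] at this
  have hhead (ε : ℤˣ) : (∃ f, S.dual.edge f = e ∧ S.dual.vtx f = i ∧ S.dual.head f = ε) ↔
      ∃ f, S.edge f = e ∧ S.cell f = i ∧ S.side f = -ε := by
    refine exists_congr fun f => and_congr_right fun _ => and_congr_right fun _ => ?_
    exact neg_eq_iff_eq_neg (a := S.side f)
  simp only [D₁bar, D₂, D₁, Matrix.neg_apply, transpose_apply, of_apply]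
  rw [hhead, hhead, neg_neg]
  split_ifs with h₁ h₂
  exacts [absurd h₂ (hexcl h₁), rfl, neg_neg (1 : ℝ), neg_zero]

theorem inner_lineMap_unitNormal {u : VField F} (hu : ∀ f, u f ∈ rtFun) (f : F) (t : ℝ) :
    inner ℝ (u f (AffineMap.lineMap (S.pt₁ f) (S.pt₀ f) t)) (unitNormal (S.pt₁ f) (S.pt₀ f)) =
      -((S.len f)⁻¹ * S.flux 2 u f) := by
  have hflux : cross (u f (S.pt₁ f)) (S.pt₀ f - S.pt₁ f) = -S.flux 2 u f := by
    rw [← neg_sub, cross_neg_right, neg_inj]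
    have := cross_lineMap (hu f) (S.pt₀ f) (S.pt₁ f) 1
    rwa [AffineMap.lineMap_apply_one] at this
  rw [inner_unitNormal, cross_lineMap (hu f), hflux, mul_neg, len]

theorem lineIntegral_inner_unitNormal {u : VField F} (hu : ∀ f, u f ∈ rtFun) (f : F) :
    lineIntegral (S.pt₁ f) (S.pt₀ f)
      (fun x => inner ℝ (u f x) (unitNormal (S.pt₁ f) (S.pt₀ f))) = -S.flux 2 u f := by
  simp only [lineIntegral, S.inner_lineMap_unitNormal hu, intervalIntegral.integral_const, sub_zero,
    one_smul]
  rw [neg_mul, mul_right_comm, ← len, inv_mul_cancel₀ (S.len_pos f).ne', one_mul]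

section

variable [Fintype F]

open Classical in
theorem sum_edge {X : F → ℝ} (hX : ∀ f, X (S.ρ₂ f) = X f) (f : F) :
    ∑ g with S.edge g = S.edge f, X g = 2 * (X f + X (S.ρ₀ f)) := by
  have hfiber : (Finset.univ.filter fun g => S.edge g = S.edge f) =
      {f, S.ρ₀ f, S.ρ₂ f, S.ρ₂ (S.ρ₀ f)} := by
    ext g
    simp only [Finset.mem_filter_univ, Finset.mem_insert, Finset.mem_singleton, ← S.ρ_comm]
    rw [← S.edge_eq_iff, eq_comm]
  have hvtx : S.ρ₀ f ≠ f := fun h => S.vtx_ne f (by rw [h])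
  have hcell {g g' : F} (hg : S.cell g = S.cell f) (hg' : S.cell g' = S.cell f) :
      S.ρ₂ g ≠ g' := by
    rintro rfl
    exact S.cell_ne g (hg'.trans hg.symm)
  rw [hfiber, Finset.sum_insert, Finset.sum_insert, Finset.sum_pair, hX, hX]
  · ring
  · exact fun h => hvtx (S.dual.nbr_involutive 0 |>.injective h).symm
  · simp [(hcell _ _).symm, cell_ρ₀]
  · simp [(hcell _ _).symm, hvtx.symm, cell_ρ₀]

variable {S}

open Classical in
theorem edgeFlux_eq_sum {u : VField F} (hu : u ∈ S.RT0) (e : E) :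
    S.edgeFlux e u = -(∑ f with S.edge f = e, S.hd f * S.flux 2 u f) / 2 := by
  rw [mem_RT0_iff] at hu
  let Y (f : F) : ℝ := if S.edge f = e ∧ S.side f = 1 then S.hd f * S.flux 2 u f else 0
  have hY (f : F) : Y f + Y (S.ρ₂ f) = if S.edge f = e then S.hd f * S.flux 2 u f else 0 := by
    have hflux : S.flux 2 u (S.ρ₂ f) = S.flux 2 u f := hu.2 2 f
    rcases Int.units_eq_one_or (S.side f) with h | h <;>
      simp [Y, edge_ρ₂, side_ρ₂, hd_ρ₂, hflux, h]
  have hflux : S.edgeFlux e u = -∑ f, Y f := by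
    simp only [edgeFlux, S.lineIntegral_inner_unitNormal hu.1, Y, ← Finset.sum_filter, mul_neg,
      Finset.sum_neg_distrib, hd]
  rw [Finset.sum_filter, ← Finset.sum_congr rfl fun f _ => hY f, Finset.sum_add_distrib,
    show ∑ f, Y (S.ρ₂ f) = ∑ f, Y f from sum_comp_of_involutive (S.nbr_involutive 2) Y, hflux]
  ring

theorem edgeFlux_edge {u : VField F} (hu : u ∈ S.RT0) (f : F) :
    S.edgeFlux (S.edge f) u = S.hd f * (S.flux 2 u (S.ρ₀ f) - S.flux 2 u f) := by
  rw [edgeFlux_eq_sum hu, S.sum_edge fun f => ?_]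
  · rw [hd_ρ₀]
    ring
  · rw [hd_ρ₂, show S.flux 2 u (S.ρ₂ f) = _ from (mem_RT0_iff.mp hu).2 2 f]

open Classical in
theorem cellIntegral_div {u : VField F} (hu : u ∈ S.RT0) (i : C) :
    S.cellIntegral i (div u) = -∑ f with S.cell f = i, S.sg f * S.flux 2 u f := by
  have htri (f : F) : ∫ x in S.tri f, div u f x = -∑ k, S.sg f * S.flux k u f := by
    rw [tri_eq_triangle, setIntegral_triangle (S.jac_ne_zero f)
      ⟨0, div u f 0, fun x => by rw [div_apply hu, div_apply hu, inner_zero_left, zero_add]⟩,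
      div_apply hu, ← area, neg_mul, mul_neg, mul_inv_cancel_left₀ (S.area_pos f).ne']
  have hinner (k : Fin 3) (hk : ∀ f, S.cell (S.nbr k f) = S.cell f) :
      ∑ f with S.cell f = i, S.sg f * S.flux k u f = 0 := by
    have := sum_mul_sg_mul_flux hu (k := k) (χ := fun f => if S.cell f = i then 1 else 0)
      fun f => by rw [hk]
    simpa only [boole_mul, ← Finset.sum_filter] using this
  simp only [cellIntegral, htri, Finset.sum_neg_distrib, Fin.sum_univ_three, Finset.sum_add_distrib,
    hinner 0 S.cell_ρ₀, hinner 1 S.cell_ρ₁, zero_add]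

theorem D₂_mulVec_edgeFlux [Fintype E] {u : VField F} (hu : u ∈ S.RT0) :
    (S.D₂ *ᵥ fun e => S.edgeFlux e u) = fun i => S.cellIntegral i (div u) := by
  classical
  funext i
  let χ (f : F) : ℝ := if S.cell f = i then 1 else 0
  have hD₂ (f : F) : S.D₂ i (S.edge f) = S.sg f * S.hd f * (χ f - χ (S.ρ₂ f)) := by
    have h := S.dual.D₁_edge_apply f i
    rw [← D₁bar_eq_dual_D₁, dual_hd, neg_mul] at h
    exact neg_injective h
  have hswap : ∑ f, χ (S.ρ₂ f) * (S.sg f * S.flux 2 u f) =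
      -∑ f, χ f * (S.sg f * S.flux 2 u f) := by
    rw [← sum_comp_of_involutive (S.nbr_involutive 2), ← Finset.sum_neg_distrib]
    refine Finset.sum_congr rfl fun f _ => ?_
    rw [show S.nbr 2 f = S.ρ₂ f from rfl, S.ρ₂_invol, sg_ρ₂,
      show S.flux 2 u (S.ρ₂ f) = _ from (mem_RT0_iff.mp hu).2 2 f]
    ring
  calc _ = ∑ e, ∑ f with S.edge f = e, -(χ f - χ (S.ρ₂ f)) * (S.sg f * S.flux 2 u f) / 2 := by
        refine Finset.sum_congr rfl fun e _ => ?_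
        beta_reduce
        rw [edgeFlux_eq_sum hu, ← Finset.sum_neg_distrib, Finset.sum_div, Finset.mul_sum]
        refine Finset.sum_congr rfl fun f hf => ?_
        rw [← (Finset.mem_filter.mp hf).2, hD₂]
        linear_combination
          -(S.sg f * (χ f - χ (S.ρ₂ f)) * S.flux 2 u f) / 2 * S.hd_mul_self f
    _ = -∑ f, χ f * (S.sg f * S.flux 2 u f) := by
        rw [Finset.sum_fiberwise Finset.univ S.edge, ← Finset.sum_div]
        simp only [neg_mul, sub_mul, Finset.sum_neg_distrib, Finset.sum_sub_distrib, hswap]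
        ring
    _ = S.cellIntegral i (div u) := by
        rw [cellIntegral_div hu, Finset.sum_filter]
        simp only [χ, boole_mul]

end

end

/-! ### Compound elements -/

section

variable {F V E C : Type*} {S : Mesh F V E C}

variable [Fintype F]

variable (S) in
/-- The piecewise constant function with integral `Φ i` over the cell `i`. -/
def cellField : (C → ℝ) →ₗ[ℝ] SField F where
  toFun Φ f _ := (S.cellArea (S.cell f))⁻¹ * Φ (S.cell f)
  map_add' _ _ := funext fun _ => funext fun _ => mul_add _ _ _
  map_smul' _ _ := funext fun _ => funext fun _ => mul_left_comm _ _ _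

theorem mem_V2_iff {q : SField F} : q ∈ S.V2 ↔ q ∈ LinearMap.range S.cellField := by
  constructor
  · intro hq
    choose κ hκ using hq
    exact ⟨fun i => S.cellArea i * κ i, funext fun f => funext fun x =>
      (inv_mul_cancel_left₀ (S.cellArea_pos _).ne' _).trans (hκ _ f rfl x).symm⟩
  · rintro ⟨Φ, rfl⟩ i
    exact ⟨(S.cellArea i)⁻¹ * Φ i, fun f hf x => by rw [← hf]; rfl⟩

theorem cellIntegral_cellField (Φ : C → ℝ) (i : C) : S.cellIntegral i (S.cellField Φ) = Φ i := by
  classical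
  have hmean (f : F) (hf : S.cell f = i) : ∫ x in S.tri f, S.cellField Φ f x =
      S.area f * ((S.cellArea i)⁻¹ * Φ i) := by
    rw [tri_eq_triangle, setIntegral_triangle (S.jac_ne_zero f)
      ⟨0, (S.cellArea i)⁻¹ * Φ i, fun x => by rw [inner_zero_left, zero_add, ← hf]; rfl⟩, area,
      ← hf]
    rfl
  rw [cellIntegral, Finset.sum_congr rfl fun f hf => hmean f (Finset.mem_filter.mp hf).2,
    ← Finset.sum_mul, ← cellArea, mul_inv_cancel_left₀ (S.cellArea_pos i).ne']

theorem cellField_cellIntegral {q : SField F} (hq : q ∈ S.V2) :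
    S.cellField (fun i => S.cellIntegral i q) = q := by
  obtain ⟨Φ, rfl⟩ := mem_V2_iff.mp hq
  simp only [cellIntegral_cellField]

theorem mem_V1_iff {u : VField F} : u ∈ S.V1 ↔ u ∈ S.RT0 ∧
    (∃ c : E → ℝ, ∀ f, S.flux 2 u f = S.hd f * S.len f * c (S.edge f)) ∧ div u ∈ S.V2 ∧
      ∀ i, S.cellMoment i u = 0 := by
  refine and_congr_right fun hu => and_congr ?_ (and_congr_right fun _ =>
    forall_congr' fun i => forall_cellIntegral_gradPerp_eq_zero_iff hu.1 i)
  have hnormal (f : F) (t c : ℝ) : inner ℝ (u f (AffineMap.lineMap (S.pt₁ f) (S.pt₀ f) t))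
      (S.hd f • unitNormal (S.pt₁ f) (S.pt₀ f)) = c ↔
        S.flux 2 u f = S.hd f * S.len f * -c := by
    rw [inner_smul_right, S.inner_lineMap_unitNormal hu.1]
    have hlen := (S.len_pos f).ne'
    constructor
    · rintro rfl
      field_simp
      linear_combination -S.flux 2 u f * S.hd_mul_self f
    · intro h
      rw [h]
      field_simp
      linear_combination c * S.hd_mul_self f
  constructor
  · intro h
    choose c hc using h
    exact ⟨-c, fun f => (hnormal f 0 _).mp (hc _ f rfl 0 (by simp))⟩
  · rintro ⟨c, hc⟩ e
    exact ⟨-c e, by rintro f rfl t _; exact (hnormal f t _).mpr (by rw [neg_neg]; exact hc f)⟩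

theorem mem_V0_iff {q : SField F} : q ∈ S.V0 ↔ q ∈ S.P1 ∧ gradPerp q ∈ S.V1 := by
  have hnormal (f : F) (x A B : Plane) (c : ℝ) :
      inner ℝ (gradPerp q f x) (c • unitNormal A B) =
        -inner ℝ (grad q f x) (c • unitTangent A B) := by
    rw [gradPerp, unitNormal, smul_neg, inner_neg_right, inner_smul_right, inner_rot_rot,
      inner_smul_right]
  refine and_congr_right fun hq => ?_
  simp only [V1, Set.mem_ofPred_eq, gradPerp_mem_RT0 hq, true_and, div_gradPerp hq]
  refine and_congr (forall_congr' fun e => ?_) ?_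
  · simp only [hnormal]
    exact (Equiv.neg ℝ).exists_congr fun c => by simp only [Equiv.neg_apply, neg_inj]
  · simp only [gradPerp, inner_rot_rot]
    exact (and_iff_right fun i => ⟨0, fun _ _ _ => rfl⟩).symm

omit [Fintype F] in
theorem gradPerp_add {p q : SField F} (hp : p ∈ S.P1) (hq : q ∈ S.P1) :
    gradPerp (p + q) = gradPerp p + gradPerp q := by
  funext f x
  simp only [gradPerp, grad, Pi.add_apply]
  rw [gradient_add ((mem_P1_iff.mp hp).1 f) ((mem_P1_iff.mp hq).1 f), rot_add]

omit [Fintype F] in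
theorem gradPerp_smul (c : ℝ) {q : SField F} (hq : q ∈ S.P1) :
    gradPerp (c • q) = c • gradPerp q := by
  funext f x
  simp only [gradPerp, grad, Pi.smul_apply]
  rw [gradient_smul ((mem_P1_iff.mp hq).1 f), rot_smul]

omit [Fintype F] in
theorem div_add {u w : VField F} (hu : u ∈ S.RT0) (hw : w ∈ S.RT0) :
    div (u + w) = div u + div w := by
  funext f x
  simp only [Pi.add_apply, div_apply hu, div_apply hw, div_apply (S.RT0Space.add_mem hu hw),
    map_add, mul_add, Finset.sum_add_distrib]

omit [Fintype F] in
theorem div_smul (c : ℝ) {u : VField F} (hu : u ∈ S.RT0) : div (c • u) = c • div u := by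
  funext f x
  simp only [Pi.smul_apply, div_apply hu, div_apply (S.RT0Space.smul_mem c hu), map_smul,
    smul_eq_mul, mul_left_comm _ c, ← Finset.mul_sum]

variable (S) in
/-- The compound Raviart-Thomas elements as a vector space. -/
def V1Space : Submodule ℝ (VField F) where
  carrier := S.V1
  zero_mem' := by
    have hdiv : div (0 : VField F) = 0 := by simpa using div_smul 0 S.RT0Space.zero_mem
    refine mem_V1_iff.mpr ⟨S.RT0Space.zero_mem, ⟨0, fun f => ?_⟩, ?_, fun i => map_zero _⟩
    · rw [map_zero, Pi.zero_apply, Pi.zero_apply, mul_zero]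
    · rw [hdiv, mem_V2_iff]
      exact zero_mem _
  add_mem' {u w} hu hw := by
    rw [mem_V1_iff] at hu hw ⊢
    obtain ⟨hu, ⟨c, hc⟩, hdiv, hcurl⟩ := hu
    obtain ⟨hw, ⟨d, hd⟩, hdiv', hcurl'⟩ := hw
    refine ⟨S.RT0Space.add_mem hu hw, ⟨c + d, fun f => ?_⟩, ?_, fun i => ?_⟩
    · rw [map_add, Pi.add_apply, hc, hd, Pi.add_apply, mul_add]
    · rw [mem_V2_iff] at hdiv hdiv' ⊢
      rw [div_add hu hw]
      exact add_mem hdiv hdiv'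
    · rw [map_add, hcurl, hcurl', add_zero]
  smul_mem' r u hu := by
    rw [mem_V1_iff] at hu ⊢
    obtain ⟨hu, ⟨c, hc⟩, hdiv, hcurl⟩ := hu
    refine ⟨S.RT0Space.smul_mem r hu, ⟨r • c, fun f => ?_⟩, ?_, fun i => ?_⟩
    · rw [map_smul, Pi.smul_apply, hc, Pi.smul_apply, smul_eq_mul, smul_eq_mul, mul_left_comm]
    · rw [mem_V2_iff] at hdiv ⊢
      rw [div_smul r hu]
      exact Submodule.smul_mem _ r hdiv
    · rw [map_smul, hcurl, smul_zero]

variable (S) in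
/-- The compound piecewise linear elements as a vector space. -/
def V0Space : Submodule ℝ (SField F) where
  carrier := S.V0
  zero_mem' := by
    have hgrad : gradPerp (0 : SField F) = 0 := by simpa using gradPerp_smul 0 S.P1Space.zero_mem
    exact mem_V0_iff.mpr ⟨S.P1Space.zero_mem, hgrad ▸ S.V1Space.zero_mem⟩
  add_mem' {p q} hp hq := by
    rw [mem_V0_iff] at hp hq ⊢
    exact ⟨S.P1Space.add_mem hp.1 hq.1,
      gradPerp_add hp.1 hq.1 ▸ S.V1Space.add_mem hp.2 hq.2⟩
  smul_mem' c q hq := by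
    rw [mem_V0_iff] at hq ⊢
    exact ⟨S.P1Space.smul_mem c hq.1, gradPerp_smul c hq.1 ▸ S.V1Space.smul_mem c hq.2⟩

end

end Mesh

/-! ### Unisolvence of the compound elements -/

theorem exists_antisymm_sum_eq {K ι F : Type*} [Field K] [Fintype ι] [Fintype F] {ρ : ι → F → F}
    (hρ : ∀ k, Function.Involutive (ρ k)) {r : F → K}
    (hr : ∀ χ : F → K, (∀ k f, χ (ρ k f) = χ f) → ∑ f, χ f * r f = 0) :
    ∃ a : ι → F → K, (∀ k f, a k (ρ k f) = -a k f) ∧ ∀ f, ∑ k, a k f = r f := by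
  classical
  -- The functions invariant under every `ρ k` form the kernel of `T`, so that a functional which
  -- vanishes on them factors through `T`; its factor encodes `a`.
  let T : (F → K) →ₗ[K] (ι → F → K) :=
    LinearMap.pi fun k => LinearMap.id - LinearMap.funLeft K K (ρ k)
  let R : Module.Dual K (F → K) := Fintype.linearCombination K r
  have hR : R ∈ LinearMap.range T.dualMap := by
    rw [LinearMap.range_dualMap_eq_dualAnnihilator_ker, Submodule.mem_dualAnnihilator]
    intro χ hχ
    refine hr χ fun k f => ?_
    have := congrFun (congrFun (LinearMap.mem_ker.mp hχ) k) f
    exact (sub_eq_zero.mp this).symm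
  obtain ⟨g, hg⟩ := hR
  let b (k : ι) (f : F) : K := g (Pi.single k (Pi.single f 1))
  refine ⟨fun k f => b k f - b k (ρ k f), fun k f => by simp only [hρ k f, neg_sub],
    fun f => ?_⟩
  have hT : T (Pi.single f 1) = fun k => Pi.single f 1 - Pi.single (ρ k f) 1 := by
    funext k f'
    have hswap : ρ k f' = f ↔ f' = ρ k f := (hρ k).eq_iff
    simp [T, LinearMap.funLeft_apply, Pi.single_apply, hswap]
  calc ∑ k, (b k f - b k (ρ k f)) = g (T (Pi.single f 1)) := by
        rw [← Finset.univ_sum_single (T (Pi.single f 1)), map_sum]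
        simp only [hT, Pi.single_sub, map_sub, b]
    _ = R (Pi.single f 1) := congrArg (· (Pi.single f 1)) hg
    _ = r f := by simp [R]

namespace Mesh

section

variable {F V E C : Type*} {S : Mesh F V E C} [Fintype F]

theorem exists_antisymm_add_eq {r : F → ℝ} (hr : ∀ κ : C → ℝ, ∑ f, κ (S.cell f) * r f = 0) :
    ∃ a : Fin 2 → F → ℝ, (∀ k f, a k (S.nbr k.castSucc f) = -a k f) ∧
      ∀ f, a 0 f + a 1 f = r f := by
  obtain ⟨a, ha, hsum⟩ := exists_antisymm_sum_eq (r := r)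
    (fun k : Fin 2 => S.nbr_involutive k.castSucc) fun χ hχ => by
      obtain ⟨κ, rfl⟩ := (Function.factorsThrough_iff _).mp (S.factorsThrough_cell (hχ 1) (hχ 0))
      exact hr κ
  exact ⟨a, ha, fun f => by rw [← hsum, Fin.sum_univ_two]⟩

omit [Fintype F] in
theorem exists_mem_RT0_div_mem_V2 [Finite F] {c : F → ℝ} (hc : ∀ f, c (S.ρ₂ f) = c f) :
    ∃ u ∈ S.RT0, S.flux 2 u = c ∧ div u ∈ S.V2 := by
  classical
  have := Fintype.ofFinite F
  have := Fintype.ofSurjective S.cell S.cell_surj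
  -- The divergence theorem prescribes the integral `Φ i` of the divergence over the cell `i`.
  let Φ (i : C) : ℝ := -∑ f with S.cell f = i, S.sg f * c f
  let r (f : F) : ℝ := -(S.area f * S.cellField Φ f 0 + S.sg f * c f)
  have hr (κ : C → ℝ) : ∑ f, κ (S.cell f) * r f = 0 := by
    rw [← Finset.sum_fiberwise Finset.univ S.cell]
    refine Finset.sum_eq_zero fun i _ => ?_
    have hr (f) (hf : S.cell f = i) : κ (S.cell f) * r f =
        -(κ i * (S.area f * ((S.cellArea i)⁻¹ * Φ i) + S.sg f * c f)) := by
      subst hf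
      exact mul_neg _ _
    rw [Finset.sum_congr rfl fun f hf => hr f (Finset.mem_filter.mp hf).2,
      Finset.sum_neg_distrib, ← Finset.mul_sum, Finset.sum_add_distrib, ← Finset.sum_mul,
      ← cellArea, mul_inv_cancel_left₀ (S.cellArea_pos i).ne', neg_add_cancel, mul_zero, neg_zero]
  obtain ⟨a, ha, hsum⟩ := exists_antisymm_add_eq hr
  let s : Fin 3 → F → ℝ := ![fun f => S.sg f * a 0 f, fun f => S.sg f * a 1 f, c]
  have hs (k f) : s k (S.nbr k f) = s k f := by
    fin_cases k
    · exact (congrArg₂ _ (S.sg_nbr 0 f) (ha 0 f)).trans (neg_mul_neg _ _)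
    · exact (congrArg₂ _ (S.sg_nbr 1 f) (ha 1 f)).trans (neg_mul_neg _ _)
    · exact hc f
  obtain ⟨u, hu, hflux⟩ := exists_mem_RT0 hs
  refine ⟨u, hu, hflux 2, mem_V2_iff.mpr ⟨Φ, funext fun f => funext fun x => ?_⟩⟩
  rw [div_apply hu, Fin.sum_univ_three, hflux, hflux, hflux]
  calc S.cellField Φ f x = -(S.area f)⁻¹ * (a 0 f + a 1 f + S.sg f * c f) := by
        rw [hsum f, show r f = -(_ + _) from rfl, neg_add, neg_add_cancel_right, neg_mul_neg,
          inv_mul_cancel_left₀ (S.area_pos f).ne']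
        rfl
    _ = -(S.area f)⁻¹ * (S.sg f * (S.sg f * a 0 f) + S.sg f * (S.sg f * a 1 f) +
          S.sg f * c f) := by
        linear_combination (S.area f)⁻¹ * (a 0 f + a 1 f) * S.sg_mul_self f

theorem exists_mem_V1_flux_eq (c : E → ℝ) :
    ∃ u ∈ S.V1, ∀ f, S.flux 2 u f = S.hd f * S.len f * c (S.edge f) := by
  obtain ⟨u, hu, hflux, hdiv⟩ :=
    exists_mem_RT0_div_mem_V2 (S := S) (c := fun f => S.hd f * S.len f * c (S.edge f)) fun f => by
      rw [hd_ρ₂, len_ρ₂, edge_ρ₂]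
  obtain ⟨κ, hκ⟩ := S.exists_cellMoment_gradPerp_bubble_eq fun i => -S.cellMoment i u
  have hbubble := gradPerp_mem_RT0 (bubble_mem_P1 (S := S) κ)
  have hflux' (f : F) : S.flux 2 (u + gradPerp (S.bubble κ)) f =
      S.hd f * S.len f * c (S.edge f) := by
    rw [map_add, Pi.add_apply, hflux, flux_gradPerp (bubble_mem_P1 κ), nodal_bubble, nodal_bubble]
    simp
  refine ⟨_, mem_V1_iff.mpr ⟨S.RT0Space.add_mem hu hbubble, ⟨c, hflux'⟩, ?_, fun i => ?_⟩, hflux'⟩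
  · rwa [div_add hu hbubble, div_gradPerp (bubble_mem_P1 κ), add_zero]
  · rw [map_add, hκ, add_neg_cancel]

omit [Fintype F] in
theorem exists_eq_gradPerp_bubble {u : VField F} (hu : u ∈ S.RT0) (hdiv : div u = 0)
    (h : S.flux 2 u = 0) : ∃ κ, u = gradPerp (S.bubble κ) := by
  have hsum (f : F) : S.flux 0 u f + S.flux 1 u f = 0 := by
    have := congrFun (congrFun hdiv f) 0
    rw [div_apply hu, ← Finset.mul_sum, Fin.sum_univ_three, h] at this
    have hsg : S.sg f ≠ 0 := left_ne_zero_of_mul (S.sg_mul_jac_pos f).ne'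
    simpa [(S.area_pos f).ne', hsg] using this
  have hflux₀ : (-S.flux 0 u).FactorsThrough S.cell := by
    have h₁ : S.flux 1 u = -S.flux 0 u := funext fun f => eq_neg_of_add_eq_zero_right (hsum f)
    refine S.factorsThrough_cell (fun f => ?_) fun f => ?_
    · rw [← h₁]
      exact (mem_RT0_iff.mp hu).2 1 f
    · exact congrArg (-·) ((mem_RT0_iff.mp hu).2 0 f)
  obtain ⟨κ, hκ⟩ := (Function.factorsThrough_iff _).mp hflux₀
  refine ⟨κ, eq_of_flux_eq hu (gradPerp_mem_RT0 (bubble_mem_P1 κ)) fun k => funext fun f => ?_⟩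
  have hκf : -S.flux 0 u f = κ (S.cell f) := congrFun hκ f
  have hf := hsum f
  rw [flux_gradPerp (bubble_mem_P1 κ), nodal_bubble, nodal_bubble, ← hκf]
  fin_cases k
  · simp
  · simp
    linarith
  · simp [h]

theorem eq_zero_of_flux_eq_zero {u : VField F} (hu : u ∈ S.V1) (h : S.flux 2 u = 0) : u = 0 := by
  obtain ⟨hRT0, -, hdiv, hcurl⟩ := mem_V1_iff.mp hu
  have hdiv₀ : div u = 0 := by
    rw [← cellField_cellIntegral hdiv]
    simp only [cellIntegral_div hRT0, h, Pi.zero_apply, mul_zero, Finset.sum_const_zero, neg_zero]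
    exact map_zero _
  obtain ⟨κ, rfl⟩ := exists_eq_gradPerp_bubble hRT0 hdiv₀ h
  have hκ : κ = 0 := funext fun i => by
    have := hcurl i
    rw [cellMoment_gradPerp_bubble] at this
    exact (mul_eq_zero.mp this).resolve_right (S.cellMoment_gradPerp_bubble_pos i).ne'
  funext f x
  rw [gradPerp_bubble, hκ, Pi.zero_apply, zero_smul]
  rfl

end

section

variable {F V E C : Type*} (S : Mesh F V E C) [Fintype F]

open Classical in
/-- The length of an edge. Each of its two segments is a side of two facets. -/
def edgeLen (e : E) : ℝ := (∑ f with S.edge f = e, S.len f) / 2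

theorem edgeLen_edge (f : F) : S.edgeLen (S.edge f) = S.len f + S.len (S.ρ₀ f) := by
  rw [edgeLen, S.sum_edge S.len_ρ₂, mul_div_cancel_left₀ _ two_ne_zero]

theorem edgeLen_pos (e : E) : 0 < S.edgeLen e := by
  obtain ⟨f, rfl⟩ := S.edge_surj e
  rw [edgeLen_edge]
  exact add_pos (S.len_pos _) (S.len_pos _)

variable {S} in
theorem edgeFlux_eq_of_flux_eq {u : VField F} (hu : u ∈ S.RT0) {c : E → ℝ}
    (hc : ∀ f, S.flux 2 u f = S.hd f * S.len f * c (S.edge f)) (e : E) :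
    S.edgeFlux e u = -(S.edgeLen e * c e) := by
  obtain ⟨f, rfl⟩ := S.edge_surj e
  rw [edgeFlux_edge hu, hc, hc, edge_ρ₀, hd_ρ₀, edgeLen_edge]
  linear_combination -(S.len f + S.len (S.ρ₀ f)) * c (S.edge f) * S.hd_mul_self f

/-- The fluxes of a compound Raviart-Thomas element through the edges. -/
def edgeFluxMap : S.V1Space →ₗ[ℝ] E → ℝ where
  toFun u e := S.edgeFlux e u
  map_add' u w := funext fun e => by
    rw [Pi.add_apply, edgeFlux_eq_sum u.2.1, edgeFlux_eq_sum w.2.1, edgeFlux_eq_sum (u + w).2.1]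
    simp only [Submodule.coe_add, map_add, Pi.add_apply, mul_add, Finset.sum_add_distrib]
    ring
  map_smul' r u := funext fun e => by
    rw [Pi.smul_apply, edgeFlux_eq_sum u.2.1, edgeFlux_eq_sum (r • u).2.1]
    simp only [Submodule.coe_smul, map_smul, Pi.smul_apply, smul_eq_mul, mul_left_comm _ r,
      ← Finset.mul_sum, RingHom.id_apply]
    ring

theorem bijective_edgeFluxMap : Function.Bijective S.edgeFluxMap := by
  constructor
  · rw [injective_iff_map_eq_zero]
    intro u hu
    obtain ⟨hRT0, ⟨c, hc⟩, -⟩ := mem_V1_iff.mp u.2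
    refine Subtype.ext (eq_zero_of_flux_eq_zero u.2 (funext fun f => ?_))
    have hflux := edgeFlux_eq_of_flux_eq hRT0 hc (S.edge f)
    rw [show S.edgeFlux (S.edge f) u = 0 from congrFun hu _, zero_eq_neg] at hflux
    rw [hc, (mul_eq_zero.mp hflux).resolve_left (S.edgeLen_pos _).ne', mul_zero, Pi.zero_apply]
  · intro Φ
    obtain ⟨u, hu, hflux⟩ := exists_mem_V1_flux_eq (S := S) fun e => -(Φ e / S.edgeLen e)
    refine ⟨⟨u, hu⟩, funext fun e => ?_⟩
    refine (edgeFlux_eq_of_flux_eq (c := fun e => -(Φ e / S.edgeLen e)) hu.1 hflux e).trans ?_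
    rw [mul_neg, neg_neg, mul_div_cancel₀ _ (S.edgeLen_pos e).ne']

/-- The compound Raviart-Thomas element with flux `Φ e` through every edge `e`. -/
def edgeField : (E → ℝ) →ₗ[ℝ] VField F :=
  S.V1Space.subtype ∘ₗ (LinearEquiv.ofBijective _ S.bijective_edgeFluxMap).symm

theorem edgeField_mem (Φ : E → ℝ) : S.edgeField Φ ∈ S.V1 := Subtype.coe_prop _

theorem edgeFlux_edgeField (Φ : E → ℝ) (e : E) : S.edgeFlux e (S.edgeField Φ) = Φ e :=
  congrFun ((LinearEquiv.ofBijective _ S.bijective_edgeFluxMap).apply_symm_apply Φ) e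

omit [Fintype F] in
variable {S} in
theorem flux_two_gradPerp {q : SField F} (hq : q ∈ S.P1) (f : F) :
    S.flux 2 (gradPerp q) f = S.nodal 0 q f - S.nodal 1 q f :=
  flux_gradPerp hq 2 f

variable {S} in
theorem exists_mem_V0_nodal_eq {q : SField F} (hq : q ∈ S.P1) {c : E → ℝ}
    (hc : ∀ f, S.flux 2 (gradPerp q) f = S.hd f * S.len f * c (S.edge f)) :
    ∃ p ∈ S.V0, S.nodal 0 p = S.nodal 0 q := by
  obtain ⟨b, hb⟩ := S.exists_cellMoment_gradPerp_bubble_eq fun i => -S.cellMoment i (gradPerp q)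
  have hbubble : S.bubble b ∈ S.P1 := bubble_mem_P1 b
  have hqb : q + S.bubble b ∈ S.P1 := S.P1Space.add_mem hq hbubble
  have hval (k : Fin 3) (hk : k ≠ 2) : S.nodal k (q + S.bubble b) = S.nodal k q := by
    funext f
    rw [map_add, Pi.add_apply, nodal_bubble, Pi.single_eq_of_ne hk, mul_zero, add_zero]
  refine ⟨q + S.bubble b, mem_V0_iff.mpr ⟨hqb, mem_V1_iff.mpr ⟨gradPerp_mem_RT0 hqb,
    ⟨c, fun f => ?_⟩, ?_, fun i => ?_⟩⟩, hval 0 (by decide)⟩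
  · rw [← hc, flux_two_gradPerp hqb, hval 0 (by decide), hval 1 (by decide), flux_two_gradPerp hq]
  · rw [div_gradPerp hqb, mem_V2_iff]
    exact zero_mem _
  · rw [gradPerp_add hq hbubble, map_add, hb, add_neg_cancel]

theorem exists_mem_V0_vertexValue_eq (κ : V → ℝ) : ∃ q ∈ S.V0, S.nodal 0 q = κ ∘ S.vtx := by
  classical
  have := Fintype.ofSurjective S.vtx S.vtx_surj
  let c (e : E) : ℝ := (S.D₁ *ᵥ κ) e / S.edgeLen e
  -- The values at the points `x_e` interpolate linearly along every edge.
  let mid (f : F) : ℝ := κ (S.vtx f) - S.hd f * S.len f * c (S.edge f)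
  have hmid₀ (f : F) : mid (S.ρ₀ f) = mid f := by
    have hc : S.edgeLen (S.edge f) * c (S.edge f) =
        S.hd f * (κ (S.vtx f) - κ (S.vtx (S.ρ₀ f))) := by
      rw [← D₁_mulVec_edge]
      exact mul_div_cancel₀ _ (S.edgeLen_pos _).ne'
    rw [edgeLen_edge] at hc
    simp only [mid, edge_ρ₀, hd_ρ₀]
    linear_combination S.hd f * hc + (κ (S.vtx f) - κ (S.vtx (S.ρ₀ f))) * S.hd_mul_self f
  have hmid₂ (f : F) : mid (S.ρ₂ f) = mid f := by
    simp only [mid, edge_ρ₂, hd_ρ₂, len_ρ₂, vtx_ρ₂]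
  have hnodal (k l : Fin 3) (hkl : k ≠ l) (f : F) :
      (![κ ∘ S.vtx, mid, 0] : Fin 3 → F → ℝ) k (S.nbr l f) =
        (![κ ∘ S.vtx, mid, 0] : Fin 3 → F → ℝ) k f := by
    match k, l, hkl with
    | 0, 0, h | 1, 1, h | 2, 2, h => exact absurd rfl h
    | 0, 1, _ => exact congrArg κ (S.vtx_ρ₁ f)
    | 0, 2, _ => exact congrArg κ (S.vtx_ρ₂ f)
    | 1, 0, _ => exact hmid₀ f
    | 1, 2, _ => exact hmid₂ f
    | 2, 0, _ | 2, 1, _ => rfl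
  obtain ⟨q, hq, hqn⟩ := exists_mem_P1 hnodal
  obtain ⟨p, hp, hpq⟩ := exists_mem_V0_nodal_eq hq (c := c) fun f => by
    rw [flux_two_gradPerp hq, hqn, hqn]
    exact sub_sub_cancel _ _
  exact ⟨p, hp, hpq.trans (hqn 0)⟩

variable {S} in
theorem edgeFlux_gradPerp {q : SField F} (hq : q ∈ S.P1) (f : F) :
    S.edgeFlux (S.edge f) (gradPerp q) = -(S.hd f * (S.nodal 0 q f - S.nodal 0 q (S.ρ₀ f))) := by
  have hmid : S.nodal 1 q (S.ρ₀ f) = S.nodal 1 q f := (mem_P1_iff.mp hq).2 1 0 (by decide) f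
  rw [edgeFlux_edge (gradPerp_mem_RT0 hq), flux_two_gradPerp hq, flux_two_gradPerp hq, hmid]
  ring

/-- The values of a compound piecewise linear element at the vertices. -/
def vertexValueMap : S.V0Space →ₗ[ℝ] V → ℝ :=
  LinearMap.funLeft ℝ ℝ (Function.surjInv S.vtx_surj) ∘ₗ S.nodal 0 ∘ₗ S.V0Space.subtype

theorem vertexValueMap_vtx (q : S.V0Space) (f : F) :
    S.vertexValueMap q (S.vtx f) = S.nodal 0 q f := by
  have hq := (mem_P1_iff.mp q.2.1).2
  exact S.factorsThrough_vtx (hq 0 1 (by decide)) (hq 0 2 (by decide))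
    (Function.surjInv_eq S.vtx_surj _)

theorem bijective_vertexValueMap : Function.Bijective S.vertexValueMap := by
  constructor
  · rw [injective_iff_map_eq_zero]
    intro q hq
    obtain ⟨hP1, hV1⟩ := mem_V0_iff.mp q.2
    have hval (f : F) : S.nodal 0 q f = 0 := by rw [← vertexValueMap_vtx, hq, Pi.zero_apply]
    have hgrad : (⟨gradPerp q, hV1⟩ : S.V1Space) = 0 := by
      refine S.bijective_edgeFluxMap.injective (funext fun e => ?_)
      obtain ⟨f, rfl⟩ := S.edge_surj e
      rw [map_zero]
      refine (edgeFlux_gradPerp hP1 f).trans ?_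
      rw [hval, hval, sub_zero, mul_zero, neg_zero, Pi.zero_apply]
    have hconst (k) (f) : S.nodal (k + 1) q f = S.nodal (k + 2) q f := by
      rw [← sub_eq_zero, ← flux_gradPerp hP1, show gradPerp (q : SField F) = 0 from
        congrArg Subtype.val hgrad, map_zero, Pi.zero_apply]
    refine Subtype.ext (eq_of_nodal_eq hP1 S.P1Space.zero_mem fun k => funext fun f => ?_)
    rw [ZeroMemClass.coe_zero, map_zero, Pi.zero_apply]
    fin_cases k
    exacts [hval f, (hconst 2 f).symm.trans (hval f), (hconst 1 f).trans (hval f)]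
  · intro κ
    obtain ⟨q, hq, hval⟩ := S.exists_mem_V0_vertexValue_eq κ
    refine ⟨⟨q, hq⟩, funext fun j => ?_⟩
    obtain ⟨f, rfl⟩ := S.vtx_surj j
    rw [vertexValueMap_vtx, hval, Function.comp_apply]

/-- The compound piecewise linear element with value `κ j` at every vertex `j`. -/
def vertexField : (V → ℝ) →ₗ[ℝ] SField F :=
  S.V0Space.subtype ∘ₗ (LinearEquiv.ofBijective _ S.bijective_vertexValueMap).symm

theorem vertexField_mem (κ : V → ℝ) : S.vertexField κ ∈ S.V0 := Subtype.coe_prop _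

theorem nodal_vertexField (κ : V → ℝ) (f : F) : S.nodal 0 (S.vertexField κ) f = κ (S.vtx f) := by
  rw [vertexField, LinearMap.comp_apply, Submodule.subtype_apply, ← vertexValueMap_vtx]
  exact congrFun ((LinearEquiv.ofBijective _ S.bijective_vertexValueMap).apply_symm_apply κ) _

variable {S}

theorem edgeField_edgeFlux {u : VField F} (hu : u ∈ S.V1) :
    S.edgeField (fun e => S.edgeFlux e u) = u :=
  congrArg Subtype.val
    ((LinearEquiv.ofBijective _ S.bijective_edgeFluxMap).symm_apply_apply ⟨u, hu⟩)

theorem vertexField_eq {q : SField F} (hq : q ∈ S.V0) {κ : V → ℝ}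
    (hκ : ∀ f, S.nodal 0 q f = κ (S.vtx f)) : S.vertexField κ = q := by
  have hval : S.vertexValueMap ⟨q, hq⟩ = κ := funext fun j => by
    obtain ⟨f, rfl⟩ := S.vtx_surj j
    rw [vertexValueMap_vtx, hκ]
  rw [← hval]
  exact congrArg Subtype.val
    ((LinearEquiv.ofBijective _ S.bijective_vertexValueMap).symm_apply_apply ⟨q, hq⟩)

/-! ### Strong derivatives -/

theorem div_edgeField [Fintype E] (Φ : E → ℝ) :
    div (S.edgeField Φ) = S.cellField (S.D₂ *ᵥ Φ) := by
  obtain ⟨hRT0, -, hdiv, -⟩ := mem_V1_iff.mp (S.edgeField_mem Φ)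
  rw [← cellField_cellIntegral hdiv, ← D₂_mulVec_edgeFlux hRT0]
  simp only [edgeFlux_edgeField]

theorem gradPerp_vertexField [Fintype V] (κ : V → ℝ) :
    gradPerp (S.vertexField κ) = -S.edgeField (S.D₁ *ᵥ κ) := by
  obtain ⟨hP1, hV1⟩ := mem_V0_iff.mp (S.vertexField_mem κ)
  rw [← edgeField_edgeFlux hV1, ← map_neg]
  congr 1
  funext e
  obtain ⟨f, rfl⟩ := S.edge_surj e
  rw [edgeFlux_gradPerp hP1, nodal_vertexField, nodal_vertexField, Pi.neg_apply, D₁_mulVec_edge]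

end

end Mesh

/-! ### Inner products of fields -/

namespace Mesh

variable {F V E C X : Type*} (S : Mesh F V E C) [Fintype F] [NormedAddCommGroup X]
  [InnerProductSpace ℝ X]

/-- The `L²` inner product of two fields with values in an inner product space, which covers scalar
and vector fields alike. -/
def fieldInner (p q : F → Plane → X) : ℝ := ∑ f, ∫ x in S.tri f, inner ℝ (p f x) (q f x)

theorem sInner_comm (p q : SField F) : S.sInner p q = S.sInner q p := by
  simp only [sInner, mul_comm]

theorem sInner_eq_fieldInner (p q : SField F) : S.sInner p q = S.fieldInner p q := S.sInner_comm p q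

theorem vInner_comm (u w : VField F) : S.vInner u w = S.vInner w u := by
  simp only [vInner, real_inner_comm]

theorem vInner_neg_left (u w : VField F) : S.vInner (-u) w = -S.vInner u w := by
  simp only [vInner, Pi.neg_apply, inner_neg_left, integral_neg, Finset.sum_neg_distrib]

variable {S} {ι κ : Type*} [Fintype ι] [Fintype κ]

theorem fieldInner_sum_smul_sum_smul {p : ι → F → Plane → X} {q : κ → F → Plane → X}
    (hp : ∀ i f, Continuous (p i f)) (hq : ∀ k f, Continuous (q k f)) (x : ι → ℝ) (y : κ → ℝ) :
    S.fieldInner (∑ i, x i • p i) (∑ k, y k • q k) =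
      x ⬝ᵥ (Matrix.of fun i k => S.fieldInner (p i) (q k)) *ᵥ y := by
  have hint (f : F) (i : ι) (k : κ) :
      IntegrableOn (fun z => x i * (y k * inner ℝ (p i f z) (q k f z))) (S.tri f) :=
    ((((hp i f).inner (hq k f)).const_mul _).const_mul _).continuousOn.integrableOn_compact
      (S.tri_eq_triangle f ▸ isCompact_triangle _)
  calc S.fieldInner (∑ i, x i • p i) (∑ k, y k • q k)
      = ∑ f, ∫ z in S.tri f, ∑ i, ∑ k, x i * (y k * inner ℝ (p i f z) (q k f z)) := by
        simp only [fieldInner, Finset.sum_apply, Pi.smul_apply, sum_inner, real_inner_smul_left]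
        simp only [inner_sum, real_inner_smul_right, Finset.mul_sum]
    _ = ∑ f, ∑ i, ∑ k, x i * (y k * ∫ z in S.tri f, inner ℝ (p i f z) (q k f z)) := by
        refine Finset.sum_congr rfl fun f _ => ?_
        rw [integral_finsetSum _ fun i _ => integrable_finsetSum _ fun k _ => hint f i k]
        refine Finset.sum_congr rfl fun i _ => ?_
        rw [integral_finsetSum _ fun k _ => hint f i k]
        simp only [integral_const_mul]
    _ = x ⬝ᵥ (Matrix.of fun i k => S.fieldInner (p i) (q k)) *ᵥ y := by
        simp only [dotProduct, mulVec, Matrix.of_apply, fieldInner, Finset.mul_sum, Finset.sum_mul]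
        rw [Finset.sum_comm]
        refine Finset.sum_congr rfl fun i _ => ?_
        rw [Finset.sum_comm]
        simp only [mul_comm (y _)]

theorem vInner_sum_smul_sum_smul {u : ι → VField F} {w : κ → VField F}
    (hu : ∀ i f, Continuous (u i f)) (hw : ∀ k f, Continuous (w k f)) (x : ι → ℝ) (y : κ → ℝ) :
    S.vInner (∑ i, x i • u i) (∑ k, y k • w k) =
      x ⬝ᵥ (Matrix.of fun i k => S.vInner (u i) (w k)) *ᵥ y :=
  fieldInner_sum_smul_sum_smul hu hw x y

theorem sInner_sum_smul_sum_smul {p : ι → SField F} {q : κ → SField F}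
    (hp : ∀ i f, Continuous (p i f)) (hq : ∀ k f, Continuous (q k f)) (x : ι → ℝ) (y : κ → ℝ) :
    S.sInner (∑ i, x i • p i) (∑ k, y k • q k) =
      x ⬝ᵥ (Matrix.of fun i k => S.sInner (p i) (q k)) *ᵥ y := by
  simp only [sInner_eq_fieldInner]
  exact fieldInner_sum_smul_sum_smul hp hq x y

theorem apply_corner_eq_zero_of_fieldInner_self {p : F → Plane → X} (hp : ∀ f, Continuous (p f))
    (h : S.fieldInner p p = 0) (f : F) (k : Fin 3) : p f (S.corner f k) = 0 := by
  rw [fieldInner, Finset.sum_eq_zero_iff_of_nonneg fun f _ =>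
    integral_nonneg fun x => real_inner_self_nonneg] at h
  have hf := h f (Finset.mem_univ f)
  rw [tri_eq_triangle] at hf
  exact inner_self_eq_zero.mp (eqOn_zero_of_setIntegral_eq_zero (convex_convexHull ℝ _)
    (isCompact_triangle _) (volume_triangle_ne_zero (S.jac_ne_zero f)) ((hp f).inner (hp f))
    (fun x => real_inner_self_nonneg) hf (subset_convexHull ℝ _ (Set.mem_range_self k)))

theorem nodal_eq_zero_of_sInner_self_eq_zero {q : SField F} (hq : ∀ f, Continuous (q f))
    (h : S.sInner q q = 0) (k : Fin 3) : S.nodal k q = 0 :=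
  funext fun f => apply_corner_eq_zero_of_fieldInner_self hq h f k

theorem flux_eq_zero_of_vInner_self_eq_zero {u : VField F} (hu : ∀ f, Continuous (u f))
    (h : S.vInner u u = 0) (k : Fin 3) : S.flux k u = 0 := by
  funext f
  change sideFlux _ _ _ = _
  rw [sideFlux_apply, apply_corner_eq_zero_of_fieldInner_self hu h]
  simp [cross]

end Mesh

/-! ### Duality -/

/-- Pointwise rotation of a vector field by a right angle. It takes the compound Raviart-Thomas
fields of the dual mesh to the elements of `V¹`. -/
def rotField {F : Type*} : VField F →ₗ[ℝ] VField F where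
  toFun u f x := rot (u f x)
  map_add' _ _ := funext fun _ => funext fun _ => rot_add _ _
  map_smul' _ _ := funext fun _ => funext fun _ => rot_smul _ _

theorem gradPerp_eq_rotField_grad {F : Type*} (q : SField F) : gradPerp q = rotField (grad q) :=
  rfl

namespace Mesh

variable {F V E C : Type*} (S : Mesh F V E C)

theorem rotField_gradPerp (q : SField F) : rotField (gradPerp q) = -grad q :=
  funext fun _ => funext fun _ => rot_rot _

theorem ContAcross.swap {ρ : F → F} {A B : F → Plane} {q : SField F} (h : ContAcross ρ A B q) :
    ContAcross ρ B A q := fun f t ht => by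
  have := h f (1 - t) ⟨by linarith [ht.2], by linarith [ht.1]⟩
  rwa [AffineMap.lineMap_apply_one_sub, AffineMap.lineMap_apply_one_sub] at this

theorem dual_P1 : S.dual.P1 = S.P1 := by
  ext q
  exact ⟨fun h => ⟨h.1, h.2.2.2.swap, h.2.2.1.swap, h.2.1.swap⟩,
    fun h => ⟨h.1, h.2.2.2.swap, h.2.2.1.swap, h.2.1.swap⟩⟩

theorem dual_tri (f : F) : S.dual.tri f = S.tri f := by
  rw [tri, tri, dual]
  congr 1
  ext x
  simp only [Set.mem_insert_iff, Set.mem_singleton_iff]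
  tauto

theorem curl_rotField {u : VField F} (hu : u ∈ S.RT0) : curl (rotField u) = div u :=
  funext fun f => funext (pcurl_rot (hu.1 f))

variable [Fintype F]

theorem dual_sInner : S.dual.sInner = S.sInner := by
  funext p q
  simp only [sInner, dual_tri]

theorem dual_vInner : S.dual.vInner = S.vInner := by
  funext u w
  simp only [vInner, dual_tri]

theorem vInner_rotField (u w : VField F) :
    S.vInner (rotField u) (rotField w) = S.vInner u w := by
  simp only [vInner, rotField, LinearMap.coe_mk, AddHom.coe_mk, inner_rot_rot]

theorem edgeCirculation_rotField (e : E) (u : VField F) :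
    S.edgeCirculation e (rotField u) = S.edgeFlux e u := by
  rw [edgeCirculation, edgeFlux]
  simp only [rotField, LinearMap.coe_mk, AddHom.coe_mk, unitNormal, inner_rot_left, inner_neg_right,
    inner_rot_right, neg_neg]

end Mesh

theorem eq_of_dotProduct_mulVec_eq {m n R : Type*} [Fintype m] [Fintype n] [CommSemiring R]
    {A B : Matrix m n R} (h : ∀ x y, x ⬝ᵥ A *ᵥ y = x ⬝ᵥ B *ᵥ y) : A = B := by
  classical
  refine Matrix.ext_of_mulVec_single fun j => dotProduct_eq _ _ fun x => ?_
  rw [dotProduct_comm, h, dotProduct_comm]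

theorem isUnit_of_dotProduct_mulVec_self {ι K : Type*} [Fintype ι] [DecidableEq ι] [Field K]
    {A : Matrix ι ι K} (h : ∀ x, x ⬝ᵥ A *ᵥ x = 0 → x = 0) : IsUnit A := by
  rw [← Matrix.mulVec_injective_iff_isUnit]
  intro x y hxy
  refine sub_eq_zero.mp (h _ ?_)
  rw [Matrix.mulVec_sub, sub_eq_zero.mpr hxy, dotProduct_zero]

theorem mulVec_eq_iff_eq_inv_mulVec {ι R : Type*} [Fintype ι] [DecidableEq ι] [CommRing R]
    {A : Matrix ι ι R} (hA : IsUnit A) (x y : ι → R) : A *ᵥ x = y ↔ x = A⁻¹ *ᵥ y := by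
  rw [Matrix.isUnit_iff_isUnit_det] at hA
  constructor
  · rintro rfl
    rw [Matrix.mulVec_mulVec, Matrix.nonsing_inv_mul _ hA, Matrix.one_mulVec]
  · rintro rfl
    rw [Matrix.mulVec_mulVec, Matrix.mul_nonsing_inv _ hA, Matrix.one_mulVec]

theorem inv_mul_mul_eq_of_mul_comm {m n R : Type*} [Fintype m] [Fintype n] [DecidableEq m]
    [DecidableEq n] [CommRing R] {M H : Matrix m m R} {D : Matrix m n R} {I L : Matrix n n R}
    (hcomm : D * I = H * D) (hI : IsUnit I) : M⁻¹ * D * L = M⁻¹ * H * D * (I⁻¹ * L) := by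
  rw [Matrix.mul_assoc _ H, ← hcomm]
  simp only [Matrix.mul_assoc]
  rw [Matrix.mul_nonsing_inv_cancel_left _ _ ((Matrix.isUnit_iff_isUnit_det _).mp hI)]

namespace Mesh

variable {F V E C : Type*} {S : Mesh F V E C}

theorem dotProduct_D₁bar_mulVec [Fintype E] [Fintype C] (x : E → ℝ) (y : C → ℝ) :
    x ⬝ᵥ S.D₁bar *ᵥ y = -((S.D₂ *ᵥ x) ⬝ᵥ y) := by
  rw [D₁bar, Matrix.neg_mulVec, dotProduct_neg, Matrix.dotProduct_mulVec, Matrix.vecMul_transpose]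

theorem dotProduct_D₂bar_mulVec [Fintype V] [Fintype E] (x : V → ℝ) (y : E → ℝ) :
    x ⬝ᵥ S.D₂bar *ᵥ y = (S.D₁ *ᵥ x) ⬝ᵥ y := by
  rw [D₂bar, Matrix.dotProduct_mulVec, Matrix.vecMul_transpose]

variable [Fintype F]

theorem grad_dual_vertexField [Fintype C] (P : C → ℝ) :
    grad (S.dual.vertexField P) = rotField (S.dual.edgeField (S.D₁bar *ᵥ P)) := by
  rw [D₁bar_eq_dual_D₁, ← neg_inj, ← rotField_gradPerp, gradPerp_vertexField, map_neg]

theorem curl_rotField_dual_edgeField [Fintype E] (U : E → ℝ) :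
    curl (rotField (S.dual.edgeField U)) = S.dual.cellField (S.D₂bar *ᵥ U) := by
  rw [S.dual.curl_rotField (S.dual.edgeField_mem U).1, div_edgeField, D₂bar_eq_dual_D₂]

/-! ### Normalized bases -/

variable [DecidableEq V] [DecidableEq E] [DecidableEq C]

namespace Basis

variable (B : S.Basis)

theorem α_eq (i : C) : B.α i = S.cellField fun i' => if i = i' then 1 else 0 := by
  simp only [← B.α_norm, cellField_cellIntegral (B.α_mem i)]

theorem v_eq (e : E) : B.v e = S.edgeField fun e' => if e = e' then 1 else 0 := by
  simp only [← B.v_norm, edgeField_edgeFlux (B.v_mem e)]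

theorem γ_eq (j : V) : B.γ j = S.vertexField fun j' => if j = j' then 1 else 0 :=
  (vertexField_eq (κ := fun j' => if j = j' then 1 else 0) (B.γ_mem j)
    fun f => B.γ_norm j _ f rfl).symm

theorem β_eq (j : V) : B.β j = S.dual.cellField fun j' => if j = j' then 1 else 0 := by
  simp only [← B.β_norm, cellField_cellIntegral (B.β_mem j)]

theorem w_eq (e : E) :
    B.w e = rotField (S.dual.edgeField fun e' => if e = e' then 1 else 0) := by
  obtain ⟨u, hu, hrot⟩ := B.w_mem e
  have hw : B.w e = rotField u := funext fun f => funext fun x => hrot f x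
  have hflux (e' : E) : S.dual.edgeFlux e' u = if e = e' then 1 else 0 := by
    rw [← edgeCirculation_rotField, ← hw, B.w_norm]
  simp only [← hflux, edgeField_edgeFlux hu, hw]

theorem χ_eq (i : C) : B.χ i = S.dual.vertexField fun i' => if i = i' then 1 else 0 :=
  (vertexField_eq (κ := fun i' => if i = i' then 1 else 0) (B.χ_mem i)
    fun f => B.χ_norm i _ f rfl).symm

end Basis

variable (S) in
/-- The normalized basis: the elements of the six compound spaces all of whose degrees of freedom
vanish, except for one that is `1`. -/
def basis : S.Basis where
  α i := S.cellField fun i' => if i = i' then 1 else 0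
  v e := S.edgeField fun e' => if e = e' then 1 else 0
  γ j := S.vertexField fun j' => if j = j' then 1 else 0
  β j := S.dual.cellField fun j' => if j = j' then 1 else 0
  w e := rotField (S.dual.edgeField fun e' => if e = e' then 1 else 0)
  χ i := S.dual.vertexField fun i' => if i = i' then 1 else 0
  α_mem _ := mem_V2_iff.mpr ⟨_, rfl⟩
  v_mem _ := S.edgeField_mem _
  γ_mem _ := S.vertexField_mem _
  β_mem _ := mem_V2_iff.mpr ⟨_, rfl⟩
  w_mem _ := ⟨_, S.dual.edgeField_mem _, fun _ _ => rfl⟩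
  χ_mem _ := S.dual.vertexField_mem _
  α_norm _ := cellIntegral_cellField _
  v_norm _ := S.edgeFlux_edgeField _
  γ_norm j j' f hf := hf ▸ S.nodal_vertexField _ f
  β_norm _ := cellIntegral_cellField _
  w_norm _ _ := by rw [edgeCirculation_rotField, edgeFlux_edgeField]
  χ_norm i i' f hf := hf ▸ S.dual.nodal_vertexField _ f

theorem eq_basis (B : S.Basis) : B = S.basis := by
  have hα := funext B.α_eq
  have hv := funext B.v_eq
  have hγ := funext B.γ_eq
  have hβ := funext B.β_eq
  have hw := funext B.w_eq
  have hχ := funext B.χ_eq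
  cases B
  subst hα hv hγ hβ hw hχ
  rfl

namespace Basis

variable (B : S.Basis)

theorem continuous_α (i : C) (f : F) : Continuous (B.α i f) := by
  rw [B.α_eq]
  exact continuous_const

theorem continuous_v (e : E) (f : F) : Continuous (B.v e f) :=
  continuous_of_mem_rtFun ((B.v_mem e).1.1 f)

theorem continuous_γ (j : V) (f : F) : Continuous (B.γ j f) :=
  continuous_of_mem_affineFun ((B.γ_mem j).1.1 f)

theorem continuous_β (j : V) (f : F) : Continuous (B.β j f) := by
  rw [B.β_eq]
  exact continuous_const

theorem continuous_w (e : E) (f : F) : Continuous (B.w e f) := by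
  rw [B.w_eq]
  exact rotL.continuous.comp (continuous_of_mem_rtFun ((S.dual.edgeField_mem _).1.1 f))

theorem continuous_χ (i : C) (f : F) : Continuous (B.χ i f) :=
  continuous_of_mem_affineFun ((B.χ_mem i).1.1 f)

section Cells

variable [Fintype C]

theorem sum_smul_α (Φ : C → ℝ) : ∑ i, Φ i • B.α i = S.cellField Φ := by
  simp only [LinearMap.pi_apply_eq_sum_univ _ Φ, B.α_eq]

theorem sum_smul_χ (P : C → ℝ) : ∑ i, P i • B.χ i = S.dual.vertexField P := by
  simp only [LinearMap.pi_apply_eq_sum_univ _ P, B.χ_eq]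

theorem dotProduct_L_mulVec (x y : C → ℝ) :
    x ⬝ᵥ B.L *ᵥ y = S.sInner (S.cellField x) (S.cellField y) := by
  rw [← B.sum_smul_α, ← B.sum_smul_α, sInner_sum_smul_sum_smul B.continuous_α B.continuous_α, L]

theorem dotProduct_I_mulVec (x y : C → ℝ) :
    x ⬝ᵥ B.I *ᵥ y = S.sInner (S.cellField x) (S.dual.vertexField y) := by
  rw [← B.sum_smul_α, ← B.sum_smul_χ, sInner_sum_smul_sum_smul B.continuous_α B.continuous_χ, I]

theorem isUnit_L : IsUnit B.L := by
  refine isUnit_of_dotProduct_mulVec_self fun x hx => ?_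
  rw [dotProduct_L_mulVec] at hx
  have hzero := nodal_eq_zero_of_sInner_self_eq_zero (fun _ => continuous_const) hx 0
  funext i
  obtain ⟨f, rfl⟩ := S.cell_surj i
  exact (mul_eq_zero.mp (congrFun hzero f)).resolve_left (inv_ne_zero (S.cellArea_pos _).ne')

end Cells

section Edges

variable [Fintype E]

theorem sum_smul_v (G : E → ℝ) : ∑ e, G e • B.v e = S.edgeField G := by
  simp only [LinearMap.pi_apply_eq_sum_univ _ G, B.v_eq]

theorem sum_smul_w (U : E → ℝ) : ∑ e, U e • B.w e = rotField (S.dual.edgeField U) := by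
  simp only [LinearMap.pi_apply_eq_sum_univ _ U, map_sum, map_smul, B.w_eq]

theorem dotProduct_M_mulVec (x y : E → ℝ) :
    x ⬝ᵥ B.M *ᵥ y = S.vInner (S.edgeField x) (S.edgeField y) := by
  rw [← B.sum_smul_v, ← B.sum_smul_v, vInner_sum_smul_sum_smul B.continuous_v B.continuous_v, M]

theorem dotProduct_H_mulVec (x y : E → ℝ) :
    x ⬝ᵥ B.H *ᵥ y = S.vInner (S.edgeField x) (rotField (S.dual.edgeField y)) := by
  rw [← B.sum_smul_v, ← B.sum_smul_w, vInner_sum_smul_sum_smul B.continuous_v B.continuous_w, H]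

theorem isUnit_M : IsUnit B.M := by
  refine isUnit_of_dotProduct_mulVec_self fun x hx => ?_
  rw [dotProduct_M_mulVec] at hx
  obtain ⟨hRT0, -⟩ := S.edgeField_mem x
  have hzero := flux_eq_zero_of_vInner_self_eq_zero
    (fun f => continuous_of_mem_rtFun (hRT0.1 f)) hx 2
  funext e
  obtain ⟨f, rfl⟩ := S.edge_surj e
  rw [← S.edgeFlux_edgeField x, edgeFlux_edge hRT0, hzero, Pi.zero_apply, Pi.zero_apply, sub_zero,
    mul_zero, Pi.zero_apply]

end Edges

section Vertices

variable [Fintype V]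

theorem sum_smul_γ (Ξ : V → ℝ) : ∑ j, Ξ j • B.γ j = S.vertexField Ξ := by
  simp only [LinearMap.pi_apply_eq_sum_univ _ Ξ, B.γ_eq]

theorem sum_smul_β (Y : V → ℝ) : ∑ j, Y j • B.β j = S.dual.cellField Y := by
  simp only [LinearMap.pi_apply_eq_sum_univ _ Y, B.β_eq]

theorem dotProduct_N_mulVec (x y : V → ℝ) :
    x ⬝ᵥ B.N *ᵥ y = S.sInner (S.vertexField x) (S.vertexField y) := by
  rw [← B.sum_smul_γ, ← B.sum_smul_γ, sInner_sum_smul_sum_smul B.continuous_γ B.continuous_γ, N]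

theorem dotProduct_J_mulVec (x y : V → ℝ) :
    x ⬝ᵥ B.J *ᵥ y = S.sInner (S.vertexField x) (S.dual.cellField y) := by
  rw [← B.sum_smul_γ, ← B.sum_smul_β, sInner_sum_smul_sum_smul B.continuous_γ B.continuous_β, J]

theorem isUnit_N : IsUnit B.N := by
  refine isUnit_of_dotProduct_mulVec_self fun x hx => ?_
  rw [dotProduct_N_mulVec] at hx
  have hzero := nodal_eq_zero_of_sInner_self_eq_zero
    (fun f => continuous_of_mem_affineFun ((S.vertexField_mem x).1.1 f)) hx 0
  funext j
  obtain ⟨f, rfl⟩ := S.vtx_surj j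
  rw [← S.nodal_vertexField x, hzero, Pi.zero_apply, Pi.zero_apply]

end Vertices

/-! ### Strong and weak derivatives -/

theorem grad_sum_smul_χ [Fintype C] [Fintype E] (P : C → ℝ) :
    grad (∑ i, P i • B.χ i) = ∑ e, (S.D₁bar *ᵥ P) e • B.w e := by
  rw [B.sum_smul_χ, B.sum_smul_w, grad_dual_vertexField]

theorem curl_sum_smul_w [Fintype E] [Fintype V] (U : E → ℝ) :
    curl (∑ e, U e • B.w e) = ∑ j, (S.D₂bar *ᵥ U) j • B.β j := by
  rw [B.sum_smul_w, B.sum_smul_β, curl_rotField_dual_edgeField]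

theorem isWeakGrad_iff [Fintype C] [Fintype E] (Φ : C → ℝ) (G : E → ℝ) :
    S.IsWeakGrad (∑ i, Φ i • B.α i) (∑ e, G e • B.v e) ↔ G = (B.M⁻¹ * S.D₁bar * B.L) *ᵥ Φ := by
  have htest (y : E → ℝ) :
      S.vInner (S.edgeField y) (S.edgeField G) = -S.sInner (div (S.edgeField y)) (S.cellField Φ) ↔
        y ⬝ᵥ B.M *ᵥ G = y ⬝ᵥ S.D₁bar *ᵥ B.L *ᵥ Φ := by
    rw [div_edgeField, ← B.dotProduct_M_mulVec, ← B.dotProduct_L_mulVec, dotProduct_D₁bar_mulVec]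
  rw [B.sum_smul_α, B.sum_smul_v, ← Matrix.mulVec_mulVec, ← Matrix.mulVec_mulVec,
    ← mulVec_eq_iff_eq_inv_mulVec B.isUnit_M]
  constructor
  · rintro ⟨-, h⟩
    refine dotProduct_eq _ _ fun y => ?_
    rw [dotProduct_comm, (htest y).mp (h _ (S.edgeField_mem y)), dotProduct_comm]
  · intro h
    refine ⟨S.edgeField_mem G, fun u hu => ?_⟩
    rw [← edgeField_edgeFlux hu, htest, h]

theorem isWeakCurl_iff [Fintype E] [Fintype V] (U : E → ℝ) (Ξ : V → ℝ) :
    S.IsWeakCurl (∑ e, U e • B.v e) (∑ j, Ξ j • B.γ j) ↔ Ξ = (B.N⁻¹ * S.D₂bar * B.M) *ᵥ U := by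
  have htest (y : V → ℝ) : S.sInner (S.vertexField y) (S.vertexField Ξ) =
      -S.vInner (gradPerp (S.vertexField y)) (S.edgeField U) ↔
        y ⬝ᵥ B.N *ᵥ Ξ = y ⬝ᵥ S.D₂bar *ᵥ B.M *ᵥ U := by
    rw [gradPerp_vertexField, ← map_neg, ← B.dotProduct_N_mulVec, ← B.dotProduct_M_mulVec,
      dotProduct_D₂bar_mulVec, neg_dotProduct, neg_neg]
  rw [B.sum_smul_v, B.sum_smul_γ, ← Matrix.mulVec_mulVec, ← Matrix.mulVec_mulVec,
    ← mulVec_eq_iff_eq_inv_mulVec B.isUnit_N]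
  constructor
  · rintro ⟨-, h⟩
    refine dotProduct_eq _ _ fun y => ?_
    rw [dotProduct_comm, (htest y).mp (h _ (S.vertexField_mem y)), dotProduct_comm]
  · intro h
    refine ⟨S.vertexField_mem Ξ, fun ψ hψ => ?_⟩
    rw [← vertexField_eq hψ fun f => (S.vertexValueMap_vtx ⟨ψ, hψ⟩ f).symm, htest, h]

/-! ### The Hodge stars commute with the derivatives -/

theorem D₁bar_mul_I [Fintype C] [Fintype E] : S.D₁bar * B.I = B.H * S.D₁bar := by
  refine eq_of_dotProduct_mulVec_eq fun y P => ?_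
  rw [← Matrix.mulVec_mulVec, ← Matrix.mulVec_mulVec]
  calc y ⬝ᵥ S.D₁bar *ᵥ B.I *ᵥ P
      = -S.sInner (div (S.edgeField y)) (S.dual.vertexField P) := by
        rw [dotProduct_D₁bar_mulVec, B.dotProduct_I_mulVec, div_edgeField]
    _ = S.vInner (S.edgeField y) (grad (S.dual.vertexField P)) :=
        neg_eq_of_add_eq_zero_right (sInner_div_add_vInner_grad (S.edgeField_mem y).1
          (S.dual_P1 ▸ (S.dual.vertexField_mem P).1))
    _ = y ⬝ᵥ B.H *ᵥ S.D₁bar *ᵥ P := by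
        rw [grad_dual_vertexField, B.dotProduct_H_mulVec]

theorem D₂bar_mul_H [Fintype E] [Fintype V] : S.D₂bar * B.H = B.J * S.D₂bar := by
  refine eq_of_dotProduct_mulVec_eq fun y U => ?_
  rw [← Matrix.mulVec_mulVec, ← Matrix.mulVec_mulVec]
  set ψ := S.vertexField y
  set u := S.dual.edgeField U
  have hparts : S.sInner (div u) ψ + S.vInner u (grad ψ) = 0 := by
    rw [← dual_sInner, ← dual_vInner]
    exact sInner_div_add_vInner_grad (S.dual.edgeField_mem U).1
      (S.dual_P1 ▸ (S.vertexField_mem y).1)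
  calc y ⬝ᵥ S.D₂bar *ᵥ B.H *ᵥ U
      = S.vInner (-gradPerp ψ) (rotField u) := by
        rw [dotProduct_D₂bar_mulVec, B.dotProduct_H_mulVec, gradPerp_vertexField, neg_neg]
    _ = -S.vInner (grad ψ) u := by
        rw [gradPerp_eq_rotField_grad, vInner_neg_left, vInner_rotField]
    _ = S.sInner ψ (div u) := by
        rw [vInner_comm, sInner_comm]
        exact neg_eq_of_add_eq_zero_left hparts
    _ = y ⬝ᵥ B.J *ᵥ S.D₂bar *ᵥ U := by
        rw [B.dotProduct_J_mulVec, ← curl_rotField_dual_edgeField,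
          curl_rotField _ (S.dual.edgeField_mem U).1]

end Basis

end Mesh

end CompoundFE

end

theorem mainTheorem5 {F V E C : Type*} [Fintype F] [Fintype V] [Fintype E] [Fintype C]
    [DecidableEq V] [DecidableEq E] [DecidableEq C] (S : CompoundFE.Mesh F V E C) :
    ∃ B : S.Basis, (∀ B' : S.Basis, B' = B) ∧
      -- the Hodge stars commute with the strong derivatives of the dual spaces
      S.D₂bar * B.H = B.J * S.D₂bar ∧
      S.D₁bar * B.I = B.H * S.D₁bar ∧
      -- the two matrices do represent these strong derivatives
      (∀ Phat : C → ℝ,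
        CompoundFE.grad (∑ i, Phat i • B.χ i) = ∑ e, (S.D₁bar *ᵥ Phat) e • B.w e) ∧
      (∀ Uhat : E → ℝ,
        CompoundFE.curl (∑ e, Uhat e • B.w e) = ∑ j, (S.D₂bar *ᵥ Uhat) j • B.β j) ∧
      -- the mass matrices are invertible, and the weak derivatives have the expected matrices
      IsUnit B.L ∧ IsUnit B.M ∧ IsUnit B.N ∧
      (∀ (Φ : C → ℝ) (G : E → ℝ),
        S.IsWeakGrad (∑ i, Φ i • B.α i) (∑ e, G e • B.v e) ↔
          G = (B.M⁻¹ * S.D₁bar * B.L) *ᵥ Φ) ∧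
      (∀ (U : E → ℝ) (Ξ : V → ℝ),
        S.IsWeakCurl (∑ e, U e • B.v e) (∑ j, Ξ j • B.γ j) ↔
          Ξ = (B.N⁻¹ * S.D₂bar * B.M) *ᵥ U) ∧
      -- weak derivative = Hodge star, dual strong derivative, Hodge star back
      (IsUnit B.I →
        B.M⁻¹ * S.D₁bar * B.L = (B.M⁻¹ * B.H) * S.D₁bar * (B.I⁻¹ * B.L)) ∧
      (IsUnit B.H →
        B.N⁻¹ * S.D₂bar * B.M = (B.N⁻¹ * B.J) * S.D₂bar * (B.H⁻¹ * B.M)) := by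
  exact ⟨S.basis, CompoundFE.Mesh.eq_basis, S.basis.D₂bar_mul_H, S.basis.D₁bar_mul_I,
    S.basis.grad_sum_smul_χ, S.basis.curl_sum_smul_w, S.basis.isUnit_L, S.basis.isUnit_M,
    S.basis.isUnit_N, S.basis.isWeakGrad_iff, S.basis.isWeakCurl_iff,
    CompoundFE.inv_mul_mul_eq_of_mul_comm S.basis.D₁bar_mul_I,
    CompoundFE.inv_mul_mul_eq_of_mul_comm S.basis.D₂bar_mul_H⟩
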